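/- Let $m\ge 1$ and let $\mathcal{C}l_m$ be the real Clifford algebra generated by $\mathbb{R}^m$ with $x^2=-\|x\|^2$, with orthonormal basis $e_1,\dots,e_m$ of $\mathbb{R}^m$, $\mathcal{C}l_m(\mathbb{C})=\mathcal{C}l_m\otimes\mathbb{C}$, norm $\|\sum_A a_Ae_A\|^2=\sum_A a_A^2$, and reversion $\widetilde{y_1\cdots y_p}=y_p\cdots y_1$. Let $D_x=\sum_i e_i\partial_{x_i}$, $\langle u,D_x\rangle=\sum_i u_i\partial_{x_i}$, $\langle D_u,D_x\rangle=\sum_i\partial_{u_i}\partial_{x_i}$, and let $\Delta_x$ be the Laplacian. Let $\mathcal{H}_1$ be the space of complex-valued harmonic polynomials in $u\in\mathbb{R}^m$ homogeneous of degree one. For a left ideal $\mathcal{S}$ of $\mathcal{C}l_m(\mathbb{C})$ (for instance the Dirac spinor space, or $\mathcal{C}l_m(\mathbb{C})$ itself) let $\mathcal{M}_1$ be the space of $\mathcal{S}$-valued polynomials $p(u)$, homogeneous of degree one, with $D_up=0$. Define the bosonic and fermionic operators $$\mathcal{D}_{1,2n}=\Delta_x^n-\frac{4n}{m+2n-2}\langle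 u,D_x\rangle\langle D_u,D_x\rangle\Delta_x^{n-1}\quad(n\ge1),$$ $$\mathcal{D}_{1,2n+1}=D_x\Delta_x^n-\frac{2}{m+2n}u\langle D_u,D_x\rangle\Delta_x^n-\frac{4n}{m+2n}\langle u,D_x\rangle\langle D_u,D_x\rangle\Delta_x^{n-1}D_x\quad(n\ge0),$$ where the last term is absent for $n=0$, acting on smooth functions of $x$ with values in $U=\mathcal{H}_1$ for even order and $U=\mathcal{M}_1$ for odd order. Let $a,b,c,d\in\mathcal{C}l_m$ satisfy the Ahlfors–Vahlen conditions: each is a finite product of vectors in $\mathbb{R}^m$; $a\tilde b,\ c\tilde d,\ \tilde c a,\ \tilde d b\in\mathbb{R}^m$; and $a\tilde d-b\tilde c=\pm1$. For every $x\in\mathbb{R}^m$ with $cx+d\neq0$, the element $cx+d$ is invertible and $$\phi(x)=(ax+b)(cx+d)^{-1},\qquad w=w(x,u)=\frac{(cx+d)\,u\,\widetilde{(cx+d)}}{\|cx+d\|^2}$$ are vectors in $\mathbb{R}^m$ (for all $u\in\mathbb{R}^m$). Moreover there is a sign $\sigma\in\{1,-1\}$, depending only on $a,b,c,d$, such that $(a\tilde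 d-b\tilde c)\,(cx+d)\widetilde{(cx+d)}=\sigma\|cx+d\|^2$ for all $x$ with $cx+d\ne0$. Put $$J_{2n}=\frac1{\|cx+d\|^{m-2n}},\quad J_{-2n}=\frac1{\|cx+d\|^{m+2n}},\quad J_{2n+1}=\frac{\widetilde{cx+d}}{\|cx+d\|^{m-2n}},\quad J_{-(2n+1)}=\frac{\widetilde{cx+d}}{\|cx+d\|^{m+2n+2}},$$ and $\sigma_k=1$ for $k$ even, $\sigma_k=\sigma$ for $k$ odd. Then for every integer $k\ge1$, every open $\Omega\subseteq\mathbb{R}^m$ and every $f\in C^\infty(\Omega,U)$, the function $(x,u)\mapsto J_kf(\phi(x),w(x,u))$ is a smooth $U$-valued function on $\{x: cx+d\neq0,\ \phi(x)\in\Omega\}$, and for all such $x$ and all $u\in\mathbb{R}^m$, with $y=\phi(x)$ and $w=w(x,u)$, $$J_{-k}\,\mathcal{D}_{1,k,y,w}f(y,w)=\sigma_k\,\mathcal{D}_{1,k,x,u}\,J_kf\Big(\phi(x),\frac{(cx+d)u\widetilde{(cx+d)}}{\|cx+d\|^2}\Big).$$ -/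

import Mathlib

open scoped ContDiff TensorProduct

noncomputable section

/-- Euclidean space `ℝ^m`. -/
abbrev Euc (m : ℕ) : Type := EuclideanSpace ℝ (Fin m)

/-- The quadratic form `x ↦ -‖x‖²` on `ℝ^m`. -/
def negSq (m : ℕ) : QuadraticForm ℝ (Euc m) :=
  -(LinearMap.BilinMap.toQuadraticMap (innerₗ (Euc m)))

theorem negSq_apply (m : ℕ) (x : Euc m) : negSq m x = -‖x‖ ^ 2 := by
  simp [negSq]

/-- The real Clifford algebra `Cl_m`, generated by `ℝ^m` with the relation `x² = -‖x‖²`. -/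
abbrev Cl (m : ℕ) : Type := CliffordAlgebra (negSq m)

/-- The embedding `ℝ^m ⊆ Cl_m`. -/
def vec {m : ℕ} (x : Euc m) : Cl m := CliffordAlgebra.ι (negSq m) x

theorem vec_mul_self {m : ℕ} (x : Euc m) :
    vec x * vec x = algebraMap ℝ (Cl m) (-‖x‖ ^ 2) := by
  rw [vec, CliffordAlgebra.ι_sq_scalar, negSq_apply]

/-- The `i`-th standard basis vector of `ℝ^m`. -/
def stdVec {m : ℕ} (i : Fin m) : Euc m := EuclideanSpace.single i 1

/-- The tilde map (reversion): the anti-automorphism `y_1 ⋯ y_p ↦ y_p ⋯ y_1`. -/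
def tilde {m : ℕ} (a : Cl m) : Cl m := CliffordAlgebra.reverse a

/-- The scalar part `a_∅` of `a = ∑_A a_A e_A`. -/
def scalarPart {m : ℕ} (a : Cl m) : ℝ :=
  ExteriorAlgebra.algebraMapInv (CliffordAlgebra.equivExterior (negSq m) a)

/-- The vector part `∑_i a_i e_i` of `a = ∑_A a_A e_A`, as an element of `ℝ^m`. -/
def vectorPart {m : ℕ} (a : Cl m) : Euc m :=
  ExteriorAlgebra.ιInv (CliffordAlgebra.equivExterior (negSq m) a)

/-- The norm on `Cl_m`: `‖a‖² = ∑_A a_A²` is the scalar part of the product of `a` with its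
Clifford conjugate (`star a` is the anti-automorphism with `star x = -x` on vectors). -/
def clNorm {m : ℕ} (a : Cl m) : ℝ := Real.sqrt (scalarPart (a * star a))

theorem Cl_finite (m : ℕ) : Module.Finite ℝ (Cl m) :=
  Module.Finite.of_basis
    ((EuclideanSpace.basisFun (Fin m) ℝ).toBasis.ExteriorAlgebra.map
      (CliffordAlgebra.equivExterior (negSq m)).symm)

instance instFiniteCl (m : ℕ) : Module.Finite ℝ (Cl m) := Cl_finite m

/-- The complex Clifford algebra `Cl_m(ℂ) = Cl_m ⊗ ℂ`. -/
abbrev ClC (m : ℕ) : Type := ℂ ⊗[ℝ] Cl m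

/-- The inclusion `Cl_m → Cl_m(ℂ)`. -/
def toClC {m : ℕ} : Cl m →ₐ[ℝ] ClC m := Algebra.TensorProduct.includeRight

/-- A norm on the finite-dimensional real vector space `Cl_m(ℂ)` (the maximum of the coordinates
in a basis). It is only used to speak of derivatives and smoothness, for which all norms on a
finite-dimensional space are equivalent. -/
instance instNormedAddCommGroupClC (m : ℕ) : NormedAddCommGroup (ClC m) :=
  NormedAddCommGroup.induced (ClC m) (Fin (Module.finrank ℝ (ClC m)) → ℝ)
    (Module.finBasis ℝ (ClC m)).equivFun.toLinearMap
    (Module.finBasis ℝ (ClC m)).equivFun.injective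

instance instNormedSpaceClC (m : ℕ) : NormedSpace ℝ (ClC m) :=
  NormedSpace.induced ℝ (ClC m) (Fin (Module.finrank ℝ (ClC m)) → ℝ)
    (Module.finBasis ℝ (ClC m)).equivFun.toLinearMap

/-! ### Differential operators -/

/-- The Dirac operator `∑_i e_i ∂_i` on `Cl_m(ℂ)`-valued functions of one vector variable. -/
def dirac {m : ℕ} (g : Euc m → ClC m) (x : Euc m) : ClC m :=
  ∑ i, toClC (vec (stdVec i)) * fderiv ℝ g x (stdVec i)

section Operators

variable {m : ℕ} {V : Type} [NormedAddCommGroup V] [NormedSpace ℝ V]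

/-- The partial derivative `∂_{x_i}` of a function of `(x, u)`. -/
def partialX (i : Fin m) (f : Euc m → Euc m → V) : Euc m → Euc m → V :=
  fun x u => fderiv ℝ (fun x' => f x' u) x (stdVec i)

/-- The partial derivative `∂_{u_i}` of a function of `(x, u)`. -/
def partialU (i : Fin m) (f : Euc m → Euc m → V) : Euc m → Euc m → V :=
  fun x u => fderiv ℝ (f x) u (stdVec i)

/-- The Laplacian `Δ_x` in the variable `x` of a function of `(x, u)`. -/
def laplaceX (f : Euc m → Euc m → V) : Euc m → Euc m → V :=
  fun x u => Laplacian.laplacian (fun x' => f x' u) x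

/-- The operator `⟨u, D_x⟩ = ∑_i u_i ∂_{x_i}`. -/
def innerUDx (f : Euc m → Euc m → V) : Euc m → Euc m → V :=
  fun x u => ∑ i, u i • partialX i f x u

/-- The operator `⟨D_u, D_x⟩ = ∑_i ∂_{u_i} ∂_{x_i}`. -/
def innerDuDx (f : Euc m → Euc m → V) : Euc m → Euc m → V :=
  fun x u => ∑ i, partialU i (partialX i f) x u

/-- The bosonic operator of order `2n` (for `n ≥ 1`):
`Δ_x^n - 4n/(m+2n-2) ⟨u,D_x⟩⟨D_u,D_x⟩Δ_x^{n-1}`. -/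
def bosonicOp (n : ℕ) (f : Euc m → Euc m → V) : Euc m → Euc m → V :=
  fun x u => laplaceX^[n] f x u
    - (4 * (n : ℝ) / ((m : ℝ) + 2 * n - 2)) • innerUDx (innerDuDx (laplaceX^[n - 1] f)) x u

end Operators

/-- The Dirac operator `D_x` in the variable `x` of a function of `(x, u)`. -/
def diracX {m : ℕ} (f : Euc m → Euc m → ClC m) : Euc m → Euc m → ClC m :=
  fun x u => dirac (fun x' => f x' u) x

/-- The fermionic operator of order `2n+1`:
`D_x Δ_x^n - 2/(m+2n) u⟨D_u,D_x⟩Δ_x^n - 4n/(m+2n) ⟨u,D_x⟩⟨D_u,D_x⟩Δ_x^{n-1}D_x`.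
For `n = 0` the last term has coefficient `0`. -/
def fermionicOp {m : ℕ} (n : ℕ) (f : Euc m → Euc m → ClC m) : Euc m → Euc m → ClC m :=
  fun x u => diracX (laplaceX^[n] f) x u
    - (2 / ((m : ℝ) + 2 * n)) • (toClC (vec u) * innerDuDx (laplaceX^[n] f) x u)
    - (4 * (n : ℝ) / ((m : ℝ) + 2 * n)) •
        innerUDx (innerDuDx (laplaceX^[n - 1] (diracX f))) x u

/-! ### Target spaces -/

/-- Homogeneous polynomial functions of degree one `u ↦ ∑_i u_i c_i` with values in `V`. -/
def IsHomogDegOne {m : ℕ} {V : Type} [AddCommGroup V] [Module ℝ V] (p : Euc m → V) : Prop :=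
  ∃ c : Fin m → V, ∀ u, p u = ∑ i, u i • c i

/-- `ℋ_1`: complex-valued harmonic polynomials, homogeneous of degree one. -/
def harmonicOne (m : ℕ) : Set (Euc m → ℂ) :=
  {p | IsHomogDegOne p ∧ ∀ u, Laplacian.laplacian p u = 0}

/-- `ℳ_1` with values in a left ideal `S` of `Cl_m(ℂ)` (such as the Dirac spinor space):
`S`-valued (left) monogenic polynomials, homogeneous of degree one. -/
def monogenicOne {m : ℕ} (S : Ideal (ClC m)) : Set (Euc m → ClC m) :=
  {p | IsHomogDegOne p ∧ (∀ u, p u ∈ S) ∧ ∀ u, dirac p u = 0}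

/-- `f ∈ C^∞(Ω, U)`, where `U` is a space of homogeneous polynomials of degree one in `u`:
`f(x, ·) ∈ U` for each `x ∈ Ω`, and `f` depends smoothly on `x`. -/
def SmoothOn {m : ℕ} {V : Type} [NormedAddCommGroup V] [NormedSpace ℝ V]
    (Ω : Set (Euc m)) (U : Set (Euc m → V)) (f : Euc m → Euc m → V) : Prop :=
  (∀ x ∈ Ω, f x ∈ U) ∧ ∀ u, ContDiffOn ℝ ∞ (fun x => f x u) Ω

/-! ### Möbius transformations -/

/-- Finite products of vectors of `ℝ^m` in `Cl_m`. -/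
def IsVectorProduct {m : ℕ} (a : Cl m) : Prop :=
  ∃ l : List (Euc m), a = (l.map vec).prod

/-- The conditions of Ahlfors and Vahlen on the coefficients of `(ax+b)(cx+d)^{-1}`. -/
structure IsAhlforsVahlen {m : ℕ} (a b c d : Cl m) : Prop where
  prod_a : IsVectorProduct a
  prod_b : IsVectorProduct b
  prod_c : IsVectorProduct c
  prod_d : IsVectorProduct d
  vec_ab : a * tilde b ∈ Set.range (vec (m := m))
  vec_cd : c * tilde d ∈ Set.range (vec (m := m))
  vec_ca : tilde c * a ∈ Set.range (vec (m := m))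
  vec_db : tilde d * b ∈ Set.range (vec (m := m))
  pseudoDet : a * tilde d - b * tilde c = 1 ∨ a * tilde d - b * tilde c = -1

/-- The Clifford number `cx + d`. -/
def denom {m : ℕ} (c d : Cl m) (x : Euc m) : Cl m := c * vec x + d

/-- `φ(x) = (ax+b)(cx+d)^{-1} ∈ ℝ^m`. -/
def mobius {m : ℕ} (a b c d : Cl m) (x : Euc m) : Euc m :=
  vectorPart ((a * vec x + b) * Ring.inverse (denom c d x))

/-- `w = (cx+d) u (cx+d)~ / ‖cx+d‖² ∈ ℝ^m`. -/
def mobiusDir {m : ℕ} (c d : Cl m) (x u : Euc m) : Euc m :=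
  vectorPart ((clNorm (denom c d x) ^ 2)⁻¹ • (denom c d x * vec u * tilde (denom c d x)))

/-- The set of `x` with `cx + d ≠ 0` and `φ(x) ∈ Ω`. -/
def mobiusPreimage {m : ℕ} (a b c d : Cl m) (Ω : Set (Euc m)) : Set (Euc m) :=
  {x | denom c d x ≠ 0 ∧ mobius a b c d x ∈ Ω}

/-- The weight `1 / ‖cx+d‖^s` with an integer exponent `s`. The bosonic weights are
`J_{2n}` with `s = m - 2n` and `J_{-2n}` with `s = m + 2n`. -/
def bosonicWeight {m : ℕ} (c d : Cl m) (s : ℤ) (x : Euc m) : ℝ :=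
  1 / clNorm (denom c d x) ^ s

/-- The weight `(cx+d)~ / ‖cx+d‖^s` with an integer exponent `s`. The fermionic weights are
`J_{2n+1}` with `s = m - 2n` and `J_{-(2n+1)}` with `s = m + 2n + 2`. -/
def fermionicWeight {m : ℕ} (c d : Cl m) (s : ℤ) (x : Euc m) : ClC m :=
  toClC ((1 / clNorm (denom c d x) ^ s) • tilde (denom c d x))

/-- `(x, u) ↦ J_{2n} f(φ(x), (cx+d)u(cx+d)~/‖cx+d‖²)`. -/
def bosonicPullback {m : ℕ} (a b c d : Cl m) (n : ℕ) (f : Euc m → Euc m → ℂ) :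
    Euc m → Euc m → ℂ :=
  fun x u => bosonicWeight c d ((m : ℤ) - 2 * n) x •
    f (mobius a b c d x) (mobiusDir c d x u)

/-- `(x, u) ↦ J_{2n+1} f(φ(x), (cx+d)u(cx+d)~/‖cx+d‖²)`. -/
def fermionicPullback {m : ℕ} (a b c d : Cl m) (n : ℕ) (f : Euc m → Euc m → ClC m) :
    Euc m → Euc m → ClC m :=
  fun x u => fermionicWeight c d ((m : ℤ) - 2 * n) x *
    f (mobius a b c d x) (mobiusDir c d x u)

end

/-! A function of degree one in `u` has the form `f(x,u) = ∑ u_j F_j(x)`, so it is the same as its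
family of components `F_j`. On components `⟨D_u,D_x⟩` becomes the divergence, `⟨u,D_x⟩` of a
function independent of `u` becomes its gradient, and `D_u f = 0` becomes `∑ e_i F_i = 0`. The
operators turn into `bos` and `ferm`, which are built only from partial derivatives and Clifford
multiplications.

A Möbius map given by an Ahlfors–Vahlen matrix is a similarity if `c = 0`, and otherwise an
inversion centred at `-v` (where `cx + d = c(x + v)`) followed by a similarity (`similarity_form`,
`inversion_form`). The direction `w` is the orthogonal part of the derivative of the map, up to
sign, applied to `u`. It is therefore enough to prove covariance under similarities, where every
term scales alike, and under one inversion.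

For the inversion everything follows from commutation relations. Multiplication by `|x|^k` (`ρ`),
composition with the inversion (`C`) and derivatives satisfy the few identities of
`InversionAction`. They give by induction the covariance of `Δ^n` with weight `|x|^(2n-m)`
(`lap_pow_ρ_C`) and of `DΔ^n` with the additional factor `x` (`dir_lap_pow_vecX_ρ_C`). On a family
of components the reflection matrix `δ_ij - 2x_i x_j/|x|²` also acts. Commuting the leading term
past it leaves gradient terms and, for odd order, Clifford terms. The divergence of the pulled-back
family contains a matching defect, multiplied by exactly the denominator `m + 2n - 2` (even order)
or `m + 2n` (odd order) of the operator, so the defects cancel (`InversionAction.bos_pull`,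
`CliffordInversion.ferm_pull`).

The sign `σ` appears in odd order only. It collects the pseudo-determinant `l`, which enters through
an odd power of the scaling factor `l/ν²`, the sign `s` with `g g̃ = sν²` for `g = d` or `g = c`,
and one more `-1` from the inversion. -/

open TopologicalSpace (Opens)


/-! ### Commutation relations of derivatives and coordinates. -/

/-- Operators `d i` and `x i` on a real vector space satisfying the canonical commutation
relations of partial derivatives and coordinate multiplications. -/
structure WeylAction (m : ℕ) (N : Type*) [AddCommGroup N] [Module ℝ N] where
  d : Fin m → N →ₗ[ℝ] N
  x : Fin m → N →ₗ[ℝ] N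
  d_comm : ∀ i j f, d i (d j f) = d j (d i f)
  x_comm : ∀ i j f, x i (x j f) = x j (x i f)
  d_x : ∀ i j f, d i (x j f) = x j (d i f) + if i = j then f else 0

namespace WeylAction

variable {m : ℕ} {N : Type*} [AddCommGroup N] [Module ℝ N] (W : WeylAction m N)

/-- The Laplacian `∑ d_i²`. -/
noncomputable def lap : Module.End ℝ N := ∑ i, W.d i ∘ₗ W.d i

/-- The Euler operator `∑ x_i d_i`. -/
noncomputable def euler : N →ₗ[ℝ] N := ∑ i, W.x i ∘ₗ W.d i

/-- The divergence of a family. -/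
noncomputable def div (F : Fin m → N) : N := ∑ i, W.d i (F i)

theorem lap_apply (f : N) : W.lap f = ∑ i, W.d i (W.d i f) := by
  simp [lap]

theorem euler_apply (f : N) : W.euler f = ∑ i, W.x i (W.d i f) := by
  simp [euler]

theorem d_lap (j : Fin m) (f : N) : W.d j (W.lap f) = W.lap (W.d j f) := by
  simp only [lap_apply, map_sum]
  exact Finset.sum_congr rfl fun i _ => by rw [W.d_comm j i, W.d_comm j i]

theorem lap_pow_succ (n : ℕ) (f : N) : (W.lap ^ (n + 1)) f = W.lap ((W.lap ^ n) f) := by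
  rw [pow_succ']; rfl

theorem d_lap_pow (n : ℕ) (j : Fin m) (f : N) :
    W.d j ((W.lap ^ n) f) = (W.lap ^ n) (W.d j f) := by
  induction n with
  | zero => simp
  | succ n ih => rw [lap_pow_succ, d_lap, ih, lap_pow_succ]

theorem lap_x (j : Fin m) (f : N) :
    W.lap (W.x j f) = W.x j (W.lap f) + (2 : ℝ) • W.d j f := by
  simp only [lap_apply, W.d_x, map_add, Finset.sum_add_distrib, map_sum, apply_ite (W.d _),
    map_zero, Finset.sum_ite_eq', Finset.mem_univ, if_true]
  module

/-- The commutator `[Δ, x_j] = 2∂_j` commutes with `Δ`, so the `n`-th power collects `n` copies of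
it. For `n = 0` the truncated exponent `n - 1` is harmless, since its coefficient vanishes. -/
theorem lap_pow_x (n : ℕ) (j : Fin m) (f : N) :
    (W.lap ^ n) (W.x j f) =
      W.x j ((W.lap ^ n) f) + (2 * n : ℝ) • W.d j ((W.lap ^ (n - 1)) f) := by
  induction n with
  | zero => simp
  | succ n ih =>
    rw [lap_pow_succ, ih, map_add, lap_x, ← lap_pow_succ, map_smul, ← W.d_lap]
    rcases n with - | n
    · simp
    · simp only [Nat.add_sub_cancel, ← lap_pow_succ]
      push_cast
      module

theorem euler_d (j : Fin m) (f : N) : W.euler (W.d j f) = W.d j (W.euler f) - W.d j f := by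
  simp only [euler_apply, map_sum, W.d_x, Finset.sum_add_distrib, Finset.sum_ite_eq,
    Finset.mem_univ, if_true]
  simp only [W.d_comm j]
  module

theorem euler_x (j : Fin m) (f : N) : W.euler (W.x j f) = W.x j (W.euler f) + W.x j f := by
  simp only [euler_apply, map_sum, W.d_x, map_add, Finset.sum_add_distrib, apply_ite (W.x _),
    map_zero, Finset.sum_ite_eq', Finset.mem_univ, if_true]
  simp only [W.x_comm j]

theorem lap_euler (f : N) : W.lap (W.euler f) = W.euler (W.lap f) + (2 : ℝ) • W.lap f := by
  have h : ∀ i g, W.d i (W.euler g) = W.euler (W.d i g) + W.d i g := fun i g => by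
    rw [euler_d]; module
  simp only [lap_apply, h, map_add, Finset.sum_add_distrib, map_sum]
  module

theorem div_x (f : N) : W.div (fun j => W.x j f) = (m : ℝ) • f + W.euler f := by
  simp only [div, W.d_x, if_true, Finset.sum_add_distrib, euler_apply, Finset.sum_const,
    Finset.card_univ, Fintype.card_fin, Nat.cast_smul_eq_nsmul]
  abel

theorem div_add (F G : Fin m → N) : W.div (fun j => F j + G j) = W.div F + W.div G := by
  simp [div, Finset.sum_add_distrib]

theorem div_smul (r : ℝ) (F : Fin m → N) : W.div (fun j => r • F j) = r • W.div F := by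
  simp [div, Finset.smul_sum]

theorem div_sub (F G : Fin m → N) : W.div (fun j => F j - G j) = W.div F - W.div G := by
  simp [div, Finset.sum_sub_distrib]

theorem div_lap_pow (n : ℕ) (F : Fin m → N) :
    W.div (fun j => (W.lap ^ n) (F j)) = (W.lap ^ n) (W.div F) := by
  simp only [div, d_lap_pow, map_sum]

/-- The bosonic operator on families of components. -/
noncomputable def bos (n : ℕ) (F : Fin m → N) (j : Fin m) : N :=
  (W.lap ^ n) (F j) - (4 * (n : ℝ) / ((m : ℝ) + 2 * n - 2)) •
    W.d j (W.div fun i => (W.lap ^ (n - 1)) (F i))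

end WeylAction

/-! ### The Dirac operator and the vector variable. -/

/-- Left multiplications by the generators of a Clifford algebra, commuting with a
Weyl action. -/
structure CliffordAction {m : ℕ} {N : Type*} [AddCommGroup N] [Module ℝ N]
    (W : WeylAction m N) where
  e : Fin m → N →ₗ[ℝ] N
  e_e : ∀ i j f, e i (e j f) = -e j (e i f) - if i = j then (2 : ℝ) • f else 0
  d_e : ∀ i j f, W.d i (e j f) = e j (W.d i f)
  x_e : ∀ i j f, W.x i (e j f) = e j (W.x i f)

namespace CliffordAction

variable {m : ℕ} {N : Type*} [AddCommGroup N] [Module ℝ N] {W : WeylAction m N}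
  (K : CliffordAction W)

/-- The Dirac operator `∑ e_i d_i`. -/
noncomputable def dir : N →ₗ[ℝ] N := ∑ i, K.e i ∘ₗ W.d i

/-- Multiplication by the vector variable `∑ e_i x_i`. -/
noncomputable def vecX : N →ₗ[ℝ] N := ∑ i, K.e i ∘ₗ W.x i

theorem dir_apply (f : N) : K.dir f = ∑ i, K.e i (W.d i f) := by simp [dir]

theorem vecX_apply (f : N) : K.vecX f = ∑ i, K.e i (W.x i f) := by simp [vecX]

/-- Exchanging `e_i` and `e_j` changes the sign of the double sum `X` up to its diagonal, so `X = -X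
- 2∑ a_ii`. This is the common source of `D² = -Δ` and `x² = -|x|²`. -/
theorem sum_e_e (a : Fin m → Fin m → N) (ha : ∀ i j, a i j = a j i) :
    ∑ i, ∑ j, K.e i (K.e j (a i j)) = -∑ i, a i i := by
  have h : ∑ i, ∑ j, K.e i (K.e j (a i j)) =
      -(∑ i, ∑ j, K.e i (K.e j (a i j))) - (2 : ℝ) • ∑ i, a i i := by
    conv_lhs =>
      rw [Finset.sum_congr rfl fun i _ => Finset.sum_congr rfl fun j _ => K.e_e i j (a i j)]
    simp only [Finset.sum_sub_distrib, Finset.sum_neg_distrib, Finset.sum_ite_eq,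
      Finset.mem_univ, if_true, Finset.smul_sum]
    rw [Finset.sum_comm]
    simp only [ha]
  have h2 : (2 : ℝ) • (∑ i, ∑ j, K.e i (K.e j (a i j))) = (2 : ℝ) • (-∑ i, a i i) := by
    rw [two_smul]
    nth_rewrite 1 [h]
    module
  exact smul_right_injective N (two_ne_zero (α := ℝ)) h2

theorem dir_dir (f : N) : K.dir (K.dir f) = -W.lap f := by
  simp only [dir_apply, map_sum, W.lap_apply, K.d_e]
  rw [Finset.sum_comm]
  exact K.sum_e_e (fun i j => W.d i (W.d j f)) fun i j => W.d_comm _ _ _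

theorem vecX_vecX (f : N) : K.vecX (K.vecX f) = -∑ i, W.x i (W.x i f) := by
  simp only [vecX_apply, map_sum, K.x_e]
  rw [Finset.sum_comm]
  exact K.sum_e_e (fun i j => W.x i (W.x j f)) fun i j => W.x_comm _ _ _

theorem d_dir (j : Fin m) (f : N) : W.d j (K.dir f) = K.dir (W.d j f) := by
  simp only [dir_apply, map_sum, K.d_e]
  exact Finset.sum_congr rfl fun i _ => by rw [W.d_comm j i]

theorem lap_dir (f : N) : W.lap (K.dir f) = K.dir (W.lap f) := by
  simp only [W.lap_apply, d_dir, map_sum]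

theorem lap_pow_dir (n : ℕ) (f : N) : (W.lap ^ n) (K.dir f) = K.dir ((W.lap ^ n) f) := by
  induction n with
  | zero => simp
  | succ n ih => rw [W.lap_pow_succ, ih, lap_dir, W.lap_pow_succ]

theorem lap_e (j : Fin m) (f : N) : W.lap (K.e j f) = K.e j (W.lap f) := by
  simp only [W.lap_apply, K.d_e, map_sum]

theorem lap_pow_e (n : ℕ) (j : Fin m) (f : N) : (W.lap ^ n) (K.e j f) = K.e j ((W.lap ^ n) f) := by
  induction n with
  | zero => simp
  | succ n ih => rw [W.lap_pow_succ, ih, lap_e, W.lap_pow_succ]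

theorem lap_pow_vecX (n : ℕ) (f : N) : (W.lap ^ n) (K.vecX f) =
    K.vecX ((W.lap ^ n) f) + (2 * n : ℝ) • K.dir ((W.lap ^ (n - 1)) f) := by
  simp only [vecX_apply, dir_apply, map_sum, lap_pow_e, W.lap_pow_x, map_add, map_smul,
    Finset.sum_add_distrib, Finset.smul_sum]

theorem dir_x (j : Fin m) (f : N) : K.dir (W.x j f) = W.x j (K.dir f) + K.e j f := by
  simp only [dir_apply, W.d_x, map_add, Finset.sum_add_distrib, apply_ite (K.e _), map_zero,
    Finset.sum_ite_eq', Finset.mem_univ, if_true, map_sum, K.x_e]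

theorem e_self (i : Fin m) (f : N) : K.e i (K.e i f) = -f := by
  have h := K.e_e i i f
  rw [if_pos rfl] at h
  have h2 : (2 : ℝ) • K.e i (K.e i f) = (2 : ℝ) • (-f) := by
    rw [two_smul]; nth_rewrite 1 [h]; module
  exact smul_right_injective N (two_ne_zero (α := ℝ)) h2

theorem dir_e (j : Fin m) (f : N) :
    K.dir (K.e j f) = -K.e j (K.dir f) - (2 : ℝ) • W.d j f := by
  simp only [dir_apply, K.d_e, K.e_e _ j, Finset.sum_sub_distrib, Finset.sum_neg_distrib,
    map_sum, Finset.sum_ite_eq', Finset.mem_univ, if_true]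

theorem dir_vecX (f : N) :
    K.dir (K.vecX f) = -K.vecX (K.dir f) - (m : ℝ) • f - (2 : ℝ) • W.euler f := by
  have h := W.div_x f
  simp only [WeylAction.div] at h
  rw [vecX_apply, vecX_apply]
  simp only [map_sum, dir_e, dir_x, map_add, K.e_self, Finset.sum_sub_distrib,
    Finset.sum_neg_distrib, Finset.sum_add_distrib, ← Finset.smul_sum, h, Finset.sum_const,
    Finset.card_univ, Fintype.card_fin, ← Nat.cast_smul_eq_nsmul ℝ]
  module

theorem vecX_e (j : Fin m) (f : N) :
    K.vecX (K.e j f) = -K.e j (K.vecX f) - (2 : ℝ) • W.x j f := by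
  simp only [vecX_apply, K.x_e, K.e_e _ j, Finset.sum_sub_distrib, Finset.sum_neg_distrib,
    map_sum, Finset.sum_ite_eq', Finset.mem_univ, if_true]

/-- The fermionic operator on families of components. -/
noncomputable def ferm (n : ℕ) (F : Fin m → N) (j : Fin m) : N :=
  K.dir ((W.lap ^ n) (F j))
    - (2 / ((m : ℝ) + 2 * n)) • K.e j (W.div fun i => (W.lap ^ n) (F i))
    - (4 * (n : ℝ) / ((m : ℝ) + 2 * n)) •
        W.d j (W.div fun i => (W.lap ^ (n - 1)) (K.dir (F i)))

theorem div_dir (F : Fin m → N) : W.div (fun i => K.dir (F i)) = K.dir (W.div F) := by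
  simp only [WeylAction.div, K.d_dir, map_sum]

/-- The divergence commutes with `D` and `Δ`, so besides `F j` only the single function `div F`
enters. -/
theorem ferm_eq (n : ℕ) (F : Fin m → N) (j : Fin m) : K.ferm n F j =
    K.dir ((W.lap ^ n) (F j)) - (2 / ((m : ℝ) + 2 * n)) • K.e j ((W.lap ^ n) (W.div F)) -
      (4 * (n : ℝ) / ((m : ℝ) + 2 * n)) • W.d j (K.dir ((W.lap ^ (n - 1)) (W.div F))) := by
  simp only [ferm, W.div_lap_pow, K.div_dir, K.lap_pow_dir]

theorem vecX_x (j : Fin m) (f : N) : K.vecX (W.x j f) = W.x j (K.vecX f) := by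
  simp only [vecX_apply, map_sum, K.x_e, W.x_comm j]

theorem d_vecX (j : Fin m) (f : N) : W.d j (K.vecX f) = K.vecX (W.d j f) + K.e j f := by
  simp only [vecX_apply, map_sum, K.d_e, W.d_x, map_add, Finset.sum_add_distrib,
    apply_ite (K.e _), map_zero, Finset.sum_ite_eq, Finset.mem_univ, if_true]

theorem dir_lap_pow_x (n : ℕ) (j : Fin m) (f : N) : K.dir ((W.lap ^ n) (W.x j f)) =
    W.x j (K.dir ((W.lap ^ n) f)) + K.e j ((W.lap ^ n) f) +
      (2 * n : ℝ) • W.d j (K.dir ((W.lap ^ (n - 1)) f)) := by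
  rw [W.lap_pow_x, map_add, map_smul, K.dir_x, K.d_dir]

end CliffordAction

/-! ### Inversion: powers of the Laplacian and bosonic operators. -/

/-- The algebraic relations satisfied by composition `C` with the inversion `x ↦ x / |x|²` and
multiplication `ρ k` by `|x|^k`. -/
structure InversionAction {m : ℕ} {A B : Type*} [AddCommGroup A] [Module ℝ A] [AddCommGroup B]
    [Module ℝ B] (V : WeylAction m A) (W : WeylAction m B) where
  C : A →ₗ[ℝ] B
  ρ : ℤ → B →ₗ[ℝ] B
  ρ_ρ : ∀ k l f, ρ k (ρ l f) = ρ (k + l) f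
  ρ_zero : ∀ f, ρ 0 f = f
  ρ_two : ∀ f, ∑ i, W.x i (W.x i f) = ρ 2 f
  x_ρ : ∀ k i f, W.x i (ρ k f) = ρ k (W.x i f)
  d_ρ : ∀ k i f, W.d i (ρ k f) = ρ k (W.d i f) + (k : ℝ) • ρ (k - 2) (W.x i f)
  -- This is the chain rule. The Jacobian of `y = x/|x|²` is `|x|⁻²(δ_ij - 2x_i x_j/|x|²)`, and the
  -- factor `x_j/|x|² = y_j` turns the second term into the Euler operator in `y`.
  d_C : ∀ i f, W.d i (C f) = ρ (-2) (C (V.d i f)) - (2 : ℝ) • ρ (-2) (W.x i (C (V.euler f)))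
  C_x : ∀ i f, C (V.x i f) = ρ (-2) (W.x i (C f))

namespace InversionAction

variable {m : ℕ} {A B : Type*} [AddCommGroup A] [Module ℝ A] [AddCommGroup B] [Module ℝ B]
  {V : WeylAction m A} {W : WeylAction m B} (I : InversionAction V W)

theorem euler_ρ (k : ℤ) (f : B) :
    W.euler (I.ρ k f) = I.ρ k (W.euler f) + (k : ℝ) • I.ρ k f := by
  simp only [W.euler_apply, I.d_ρ, map_add, map_smul, I.x_ρ, Finset.sum_add_distrib,
    ← Finset.smul_sum, ← map_sum, I.ρ_two, I.ρ_ρ, sub_add_cancel]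

theorem x_C (i : Fin m) (f : A) : W.x i (I.C f) = I.ρ 2 (I.C (V.x i f)) := by
  rw [I.C_x, I.ρ_ρ]; simp [I.ρ_zero]

theorem sum_x_C_d (f : A) : ∑ i, W.x i (I.C (V.d i f)) = I.ρ 2 (I.C (V.euler f)) := by
  simp only [I.x_C, V.euler_apply, map_sum]

/-- The inversion reverses the radial direction, so homogeneity degrees change sign. -/
theorem euler_C (f : A) : W.euler (I.C f) = -I.C (V.euler f) := by
  have h : ∀ k g, ∑ i, W.x i (I.ρ k (W.x i g)) = I.ρ (k + 2) g := fun k g => by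
    simp only [I.x_ρ, ← map_sum, I.ρ_two, I.ρ_ρ]
  rw [W.euler_apply]
  simp only [I.d_C, map_sub, map_smul, Finset.sum_sub_distrib, ← Finset.smul_sum, h]
  simp only [I.x_ρ, ← map_sum, I.sum_x_C_d, I.ρ_ρ]
  simp only [Int.reduceNeg, Int.reduceAdd, I.ρ_zero]
  module

theorem div_ρ (k : ℤ) (F : Fin m → B) : W.div (fun i => I.ρ k (F i)) =
    I.ρ k (W.div F) + (k : ℝ) • I.ρ (k - 2) (∑ i, W.x i (F i)) := by
  simp only [WeylAction.div, I.d_ρ, Finset.sum_add_distrib, map_sum, Finset.smul_sum]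

theorem lap_ρ (k : ℤ) (f : B) : W.lap (I.ρ k f) = I.ρ k (W.lap f) +
    (2 * k : ℝ) • I.ρ (k - 2) (W.euler f) + (k * (k + m - 2) : ℝ) • I.ρ (k - 2) f := by
  have h := W.div_x f
  have h2 : W.lap (I.ρ k f) = W.div (fun i => W.d i (I.ρ k f)) := by
    simp [WeylAction.div, W.lap_apply]
  have h3 : W.lap f = W.div (fun i => W.d i f) := by
    simp [WeylAction.div, W.lap_apply]
  rw [h2, h3]
  simp only [I.d_ρ, W.div_add, W.div_smul, I.div_ρ, h, I.ρ_two, I.ρ_ρ, ← W.euler_apply, map_add,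
    map_smul, sub_add_cancel]
  push_cast
  module

theorem div_C_d (f : A) : W.div (fun i => I.C (V.d i f)) = I.ρ (-2) (I.C (V.lap f)) -
    (2 : ℝ) • I.C (V.euler (V.euler f)) + (2 : ℝ) • I.C (V.euler f) := by
  have h : ∀ i, V.euler (V.d i f) = V.d i (V.euler f) - V.d i f := fun i => V.euler_d i f
  simp only [WeylAction.div, I.d_C, h, map_sub, Finset.sum_sub_distrib, ← Finset.smul_sum,
    ← map_sum, I.sum_x_C_d, I.ρ_ρ, V.lap_apply]
  simp only [Int.reduceNeg, Int.reduceAdd, I.ρ_zero]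
  module

theorem lap_C (f : A) : W.lap (I.C f) =
    I.ρ (-4) (I.C (V.lap f)) - (2 * (m - 2) : ℝ) • I.ρ (-2) (I.C (V.euler f)) := by
  have h2 : W.lap (I.C f) = W.div (fun i => W.d i (I.C f)) := by
    simp [WeylAction.div, W.lap_apply]
  rw [h2]
  simp only [I.d_C, W.div_sub, W.div_smul, I.div_ρ, W.div_x, I.sum_x_C_d, I.div_C_d, I.ρ_two,
    I.ρ_ρ, map_sub, map_add, map_smul, I.euler_C, map_neg]
  simp only [Int.reduceNeg, Int.reduceAdd, Int.reduceSub]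
  push_cast
  module

/-- Both correction terms vanish for `k = 2 - m`, which is the Kelvin transform. The other values of
`k` feed the induction for higher powers. -/
theorem lap_ρ_C (k : ℤ) (f : A) : W.lap (I.ρ k (I.C f)) = I.ρ (k - 4) (I.C (V.lap f)) -
    (2 * (m - 2) + 2 * k : ℝ) • I.ρ (k - 2) (I.C (V.euler f)) +
      (k * (k + m - 2) : ℝ) • I.ρ (k - 2) (I.C f) := by
  rw [I.lap_ρ, I.lap_C, I.euler_C]
  simp only [map_sub, map_smul, I.ρ_ρ, map_neg, ← sub_eq_add_neg]
  module

/-- This is the `sl₂` relation between `Δ`, `|x|²` and the Euler operator, iterated. -/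
theorem lap_pow_ρ_two (n : ℕ) (f : B) : (W.lap ^ (n + 1)) (I.ρ 2 f) =
    I.ρ 2 ((W.lap ^ (n + 1)) f) + (4 * (n + 1) : ℝ) • W.euler ((W.lap ^ n) f) +
      ((n + 1) * (2 * m + 4 * n) : ℝ) • (W.lap ^ n) f := by
  induction n with
  | zero =>
    simp only [zero_add, pow_one, pow_zero, I.lap_ρ, sub_self, I.ρ_zero, Module.End.one_apply]
    push_cast
    module
  | succ n ih =>
    rw [W.lap_pow_succ, ih]
    simp only [map_add, map_smul, I.lap_ρ, W.lap_euler, sub_self, I.ρ_zero, ← W.lap_pow_succ]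
    push_cast
    module

/-- Conformal covariance of powers of the Laplacian under inversion. -/
theorem lap_pow_ρ_C (n : ℕ) (f : A) : (W.lap ^ n) (I.ρ (2 * n - m) (I.C f)) =
    I.ρ (-(2 * n) - m) (I.C ((V.lap ^ n) f)) := by
  induction n generalizing f with
  | zero => simp
  | succ n ih =>
    -- The weight grows by `|x|²` at each step, so `Δ^(n+1)` is moved past this factor. The
    -- induction hypothesis handles what remains, and `lap_ρ_C` at `k = -2n - m` produces Euler and
    -- scalar terms that cancel those of the commutator.
    have h : I.ρ (2 * ((n + 1 : ℕ) : ℤ) - m) (I.C f) = I.ρ 2 (I.ρ (2 * n - m) (I.C f)) := by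
      rw [I.ρ_ρ]; congr 2; push_cast; ring
    rw [h, I.lap_pow_ρ_two, W.lap_pow_succ, ih, I.lap_ρ_C, I.euler_ρ, I.euler_C, V.lap_pow_succ]
    simp only [map_add, map_sub, map_smul, I.ρ_ρ, map_neg]
    have e1 : (2 : ℤ) + (-(2 * n) - m - 4) = -(2 * (n + 1 : ℕ)) - m := by push_cast; ring
    have e2 : (2 : ℤ) + (-(2 * n) - m - 2) = -(2 * n) - m := by ring
    rw [e1, e2]
    push_cast
    module

/-- The pairing of a family with the coordinates. -/
def pair (_ : InversionAction V W) (F : Fin m → A) : A := ∑ i, V.x i (F i)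

/-- The pullback of the components of a vector-valued function: composition with the inversion
and multiplication by the reflection matrix `δ_ij - 2 x_i x_j / |x|²`. -/
def pull (F : Fin m → A) (j : Fin m) : B := I.C (F j) - (2 : ℝ) • W.x j (I.C (I.pair F))

/-- The Jacobian of the inversion is `|x|⁻²` times the reflection matrix, so pulling back a gradient
gives `|x|²` times the gradient of the pullback. -/
theorem pull_d (f : A) (j : Fin m) : I.pull (fun i => V.d i f) j = I.ρ 2 (W.d j (I.C f)) := by
  simp only [pull, pair, ← V.euler_apply, I.d_C, map_sub, map_smul, I.ρ_ρ]
  simp only [Int.reduceNeg, Int.reduceAdd, I.ρ_zero]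

theorem pull_sub (F G : Fin m → A) (j : Fin m) :
    I.pull (fun i => F i - G i) j = I.pull F j - I.pull G j := by
  simp only [pull, pair, map_sub, Finset.sum_sub_distrib]
  module

theorem pull_smul (r : ℝ) (F : Fin m → A) (j : Fin m) :
    I.pull (fun i => r • F i) j = r • I.pull F j := by
  simp only [pull, pair, map_smul, ← Finset.smul_sum]
  module

theorem div_C (F : Fin m → A) : W.div (fun i => I.C (F i)) = I.ρ (-2) (I.C (V.div F)) -
    (2 : ℝ) • I.C (V.euler (I.pair F)) + (2 : ℝ) • I.C (I.pair F) := by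
  have h : ∑ i, W.x i (I.C (V.euler (F i))) =
      I.ρ 2 (I.C (V.euler (I.pair F) - I.pair F)) := by
    simp only [I.x_C, pair, map_sum, V.euler_x, map_sub, map_add, Finset.sum_add_distrib]
    abel
  simp only [WeylAction.div, I.d_C, Finset.sum_sub_distrib, ← Finset.smul_sum, ← map_sum, h,
    I.ρ_ρ]
  simp only [Int.reduceNeg, Int.reduceAdd, I.ρ_zero, map_sub]
  module

theorem sum_x_C (F : Fin m → A) : ∑ i, W.x i (I.C (F i)) = I.ρ 2 (I.C (I.pair F)) := by
  simp only [I.x_C, pair, map_sum]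

/-- At the bosonic weight `k = 2n - m` the coefficient of the defect is `m + 2n - 2`, the
denominator in the operator. -/
theorem div_ρ_pull (k : ℤ) (F : Fin m → A) : W.div (fun i => I.ρ k (I.pull F i)) =
    I.ρ (k - 2) (I.C (V.div F)) - (2 * m + k - 2 : ℝ) • I.ρ k (I.C (I.pair F)) := by
  simp only [pull, I.div_ρ, W.div_sub, W.div_smul, I.div_C, W.div_x, I.euler_C, map_sub,
    map_smul, I.sum_x_C, I.ρ_two, map_add, I.ρ_ρ, sub_add_cancel, ← sub_eq_add_neg]
  module

theorem lap_pow_pair (n : ℕ) (F : Fin m → A) : (V.lap ^ n) (I.pair F) =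
    I.pair (fun i => (V.lap ^ n) (F i)) +
      (2 * n : ℝ) • (V.lap ^ (n - 1)) (V.div F) := by
  simp only [pair, map_sum, V.lap_pow_x, Finset.sum_add_distrib, ← Finset.smul_sum, V.d_lap_pow,
    WeylAction.div]

/-- Conformal covariance of the bosonic operators under inversion. -/
theorem bos_pull {n : ℕ} (hm : 1 ≤ m) (hn : 1 ≤ n) (F : Fin m → A) (j : Fin m) :
    W.bos n (fun i => I.ρ (2 * n - m) (I.pull F i)) j =
      I.ρ (-(2 * n) - m) (I.pull (V.bos n F) j) := by
  obtain ⟨n, rfl⟩ : ∃ k, n = k + 1 := ⟨n - 1, by omega⟩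
  have hN : (m : ℝ) + 2 * ((n + 1 : ℕ) : ℝ) - 2 ≠ 0 := by
    have : (1 : ℝ) ≤ m := by exact_mod_cast hm
    have : (0 : ℝ) ≤ n := n.cast_nonneg
    push_cast
    linarith
  set N : ℝ := (m : ℝ) + 2 * ((n + 1 : ℕ) : ℝ) - 2 with hNdef
  set g := (V.lap ^ n) (V.div F) with hg
  set Z := (W.lap ^ n) (I.ρ (2 * (n + 1 : ℕ) - m) (I.C (I.pair F))) with hZ
  have hdiv : W.div (fun i => (W.lap ^ n) (I.ρ (2 * (n + 1 : ℕ) - m) (I.pull F i))) =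
      I.ρ (-(2 * n) - m) (I.C g) - N • Z := by
    rw [W.div_lap_pow, I.div_ρ_pull, map_sub, map_smul, ← hZ, hg, ← I.lap_pow_ρ_C]
    have e : (2 * (n + 1 : ℕ) - m - 2 : ℤ) = 2 * n - m := by push_cast; ring
    rw [e, hNdef]
    push_cast
    module
  -- The two extra terms come from commuting `Δ^(n+1)` with a coordinate: with `y_i` inside `pair`
  -- before the inversion, and with `x_j` in the reflection matrix after it.
  have hL : (W.lap ^ (n + 1)) (I.ρ (2 * (n + 1 : ℕ) - m) (I.pull F j)) =
      I.ρ (-(2 * (n + 1 : ℕ)) - m) (I.pull (fun i => (V.lap ^ (n + 1)) (F i)) j) -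
      (4 * (n + 1 : ℕ) : ℝ) • I.ρ (-(2 * (n + 1 : ℕ)) - m) (W.x j (I.C g)) -
      (4 * (n + 1 : ℕ) : ℝ) • W.d j Z := by
    simp only [pull, map_sub, map_smul, ← I.x_ρ, W.lap_pow_x, I.lap_pow_ρ_C, I.lap_pow_pair,
      map_add, Nat.add_sub_cancel]
    module
  have hb : V.bos (n + 1) F = fun i => (V.lap ^ (n + 1)) (F i) -
      (4 * ((n + 1 : ℕ) : ℝ) / N) • V.d i g := by
    funext i
    simp only [WeylAction.bos, Nat.add_sub_cancel, V.div_lap_pow, hg, hNdef]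
  rw [hb, I.pull_sub, I.pull_smul, I.pull_d, WeylAction.bos, hL, Nat.add_sub_cancel, hdiv]
  simp only [map_sub, map_smul, I.ρ_ρ, I.d_ρ]
  have e1 : (-(2 * n) - m - 2 : ℤ) = -(2 * (n + 1 : ℕ)) - m := by push_cast; ring
  have e2 : (-(2 * (n + 1 : ℕ)) - m + 2 : ℤ) = -(2 * n) - m := by push_cast; ring
  rw [e1, e2]
  -- The terms in `Z` cancel because `hdiv` carries the factor `N`. The remaining `x_j` term cancels
  -- because differentiating `|x|^(-N)` produces the coefficient `-N`.
  have e3 : ((-(2 * n) - m : ℤ) : ℝ) = -N := by rw [hNdef]; push_cast; ring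
  rw [e3, ← hNdef]
  match_scalars <;> field_simp <;> ring

theorem vecX_vecX (K : CliffordAction W) (f : B) : K.vecX (K.vecX f) = -I.ρ 2 f := by
  rw [K.vecX_vecX, I.ρ_two]

/-- Since `[D, x_i] = e_i`, moving `D` past the pairing leaves a Clifford contraction, which
monogenicity removes. -/
theorem dir_lap_pow_pair (J : CliffordAction V) (n : ℕ) (F : Fin m → A)
    (hF : ∑ i, J.e i (F i) = 0) :
    J.dir ((V.lap ^ n) (I.pair F)) = I.pair (fun i => J.dir ((V.lap ^ n) (F i))) +
      (2 * n : ℝ) • J.dir ((V.lap ^ (n - 1)) (V.div F)) := by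
  have h : ∑ i, J.e i ((V.lap ^ n) (F i)) = 0 := by
    simp only [← J.lap_pow_e, ← map_sum, hF, map_zero]
  simp only [I.lap_pow_pair, map_add, map_smul]
  simp only [pair, map_sum, J.dir_x, Finset.sum_add_distrib, h, add_zero]

end InversionAction

/-! ### Inversion: odd powers of the Dirac operator and fermionic operators. -/

/-- Compatibility of an inversion with Clifford actions. -/
structure CliffordInversion {m : ℕ} {A B : Type*} [AddCommGroup A] [Module ℝ A]
    [AddCommGroup B] [Module ℝ B] {V : WeylAction m A} {W : WeylAction m B}
    (I : InversionAction V W) (J : CliffordAction V) (K : CliffordAction W) : Prop where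
  C_e : ∀ i f, I.C (J.e i f) = K.e i (I.C f)
  ρ_e : ∀ k i f, I.ρ k (K.e i f) = K.e i (I.ρ k f)

namespace CliffordInversion

variable {m : ℕ} {A B : Type*} [AddCommGroup A] [Module ℝ A] [AddCommGroup B] [Module ℝ B]
  {V : WeylAction m A} {W : WeylAction m B} {I : InversionAction V W} {J : CliffordAction V}
  {K : CliffordAction W} (H : CliffordInversion I J K)
include H

theorem ρ_vecX (k : ℤ) (f : B) : I.ρ k (K.vecX f) = K.vecX (I.ρ k f) := by
  simp only [K.vecX_apply, map_sum, H.ρ_e, I.x_ρ]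

theorem dir_ρ (k : ℤ) (f : B) :
    K.dir (I.ρ k f) = I.ρ k (K.dir f) + (k : ℝ) • I.ρ (k - 2) (K.vecX f) := by
  simp only [K.dir_apply, I.d_ρ, map_add, map_smul, Finset.sum_add_distrib, ← Finset.smul_sum,
    K.vecX_apply, map_sum, H.ρ_e]

theorem dir_C (f : A) : K.dir (I.C f) =
    I.ρ (-2) (I.C (J.dir f)) - (2 : ℝ) • I.ρ (-2) (K.vecX (I.C (V.euler f))) := by
  simp only [K.dir_apply, J.dir_apply, K.vecX_apply, I.d_C, map_sub, map_smul, map_sum,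
    Finset.sum_sub_distrib, ← Finset.smul_sum, H.ρ_e, H.C_e]

/-- The Euler terms from `D x` and from the chain rule cancel for every `k`. At `k = -m` the scalar
term vanishes too, which is the covariance of `D` itself. -/
theorem dir_vecX_ρ_C (k : ℤ) (f : A) : K.dir (K.vecX (I.ρ k (I.C f))) =
    -K.vecX (I.ρ (k - 2) (I.C (J.dir f))) - (m + k : ℝ) • I.ρ k (I.C f) := by
  rw [K.dir_vecX, H.dir_ρ, H.dir_C, I.euler_ρ, I.euler_C]
  simp only [map_add, map_sub, map_smul, map_neg, ← H.ρ_vecX, I.vecX_vecX, I.ρ_ρ,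
    sub_add_cancel]
  simp only [show k + -2 = k - 2 from rfl, sub_add_cancel]
  module

/-- Conformal covariance of odd powers of the Dirac operator under inversion. -/
theorem dir_lap_pow_vecX_ρ_C (n : ℕ) (f : A) :
    K.dir ((W.lap ^ n) (K.vecX (I.ρ (2 * n - m) (I.C f)))) =
      -K.vecX (I.ρ (-(2 * n) - m - 2) (I.C (J.dir ((V.lap ^ n) f)))) := by
  -- Commuting `Δ^n` past `x` yields `2n DΔ^(n-1)`. A further `D` turns this into `-2nΔ^n`, which
  -- cancels the scalar term `-(m + k) = 2n` of `dir_vecX_ρ_C` at `k = -2n - m`.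
  have h : (2 * n : ℝ) • K.dir (K.dir ((W.lap ^ (n - 1)) (I.ρ (2 * n - m) (I.C f)))) =
      -((2 * n : ℝ) • (W.lap ^ n) (I.ρ (2 * n - m) (I.C f))) := by
    rcases n with - | n
    · simp
    · rw [K.dir_dir, Nat.add_sub_cancel, ← W.lap_pow_succ, smul_neg]
  rw [K.lap_pow_vecX, map_add, map_smul, h, I.lap_pow_ρ_C, H.dir_vecX_ρ_C]
  push_cast
  module

/-- The reflection of `e_j` is `x e_j x/|x|²`, and multiplying it on the left by `x` gives `-e_j x`.
-/
theorem vecX_pull_e (f : A) (j : Fin m) :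
    K.vecX (I.pull (fun i => J.e i f) j) = -K.e j (K.vecX (I.C f)) := by
  have h : I.C (I.pair fun i => J.e i f) = I.ρ (-2) (K.vecX (I.C f)) := by
    simp only [InversionAction.pair, map_sum, I.C_x, H.C_e, K.vecX_apply, K.x_e]
  simp only [InversionAction.pull, h, map_sub, map_smul, H.C_e, K.vecX_e, I.x_ρ, ← H.ρ_vecX]
  rw [K.vecX_x, I.vecX_vecX, map_neg, I.x_ρ, map_neg, I.ρ_ρ]
  simp only [Int.reduceNeg, Int.reduceAdd, I.ρ_zero]
  module

theorem sum_e_pull (F : Fin m → A) (hF : ∑ i, J.e i (F i) = 0) :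
    ∑ i, K.e i (I.pull F i) = -((2 : ℝ) • K.vecX (I.C (I.pair F))) := by
  simp only [InversionAction.pull, map_sub, map_smul, Finset.sum_sub_distrib, ← Finset.smul_sum,
    ← H.C_e, ← map_sum, hF, map_zero, zero_sub, K.vecX_apply]

/-- Reflection alone destroys monogenicity in `u`. The factor `x` restores it: the anticommutator
`-2x_i` of `e_i` and `x` produces exactly the opposite of the defect in `sum_e_pull`. -/
theorem sum_e_vecX_pull (k : ℤ) (F : Fin m → A) (hF : ∑ i, J.e i (F i) = 0) :
    ∑ i, K.e i (K.vecX (I.ρ k (I.pull F i))) = 0 := by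
  have h : ∀ i (g : B), K.e i (K.vecX g) = -K.vecX (K.e i g) - (2 : ℝ) • W.x i g := fun i g => by
    rw [K.vecX_e]; module
  have h2 : ∑ i, W.x i (I.pull F i) = -I.ρ 2 (I.C (I.pair F)) := by
    simp only [InversionAction.pull, map_sub, map_smul, Finset.sum_sub_distrib,
      ← Finset.smul_sum, I.sum_x_C, I.ρ_two]
    module
  simp only [← H.ρ_vecX, ← H.ρ_e, ← map_sum]
  simp only [h, Finset.sum_sub_distrib, Finset.sum_neg_distrib, ← Finset.smul_sum,
    ← map_sum, h2, H.sum_e_pull F hF, map_neg, map_smul, I.vecX_vecX]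
  simp

/-- Differentiating the factor `x` adds a Clifford contraction, which raises the bosonic coefficient
`2m + k - 2` to `2m + k`. At `k = 2n - m` this is the fermionic denominator `m + 2n`. -/
theorem div_vecX_ρ_pull (k : ℤ) (F : Fin m → A) (hF : ∑ i, J.e i (F i) = 0) :
    W.div (fun i => K.vecX (I.ρ k (I.pull F i))) =
      K.vecX (I.ρ (k - 2) (I.C (V.div F))) -
        (2 * m + k : ℝ) • K.vecX (I.ρ k (I.C (I.pair F))) := by
  have h : ∀ G : Fin m → B, W.div (fun i => K.vecX (G i)) =
      K.vecX (W.div G) + ∑ i, K.e i (G i) := fun G => by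
    simp only [WeylAction.div, K.vecX_apply, map_sum, K.d_e, W.d_x, map_add,
      Finset.sum_add_distrib, apply_ite (K.e _), map_zero, Finset.sum_ite_eq, Finset.mem_univ,
      if_true]
    rw [Finset.sum_comm]
  rw [h, I.div_ρ_pull]
  simp only [← H.ρ_e, ← map_sum, H.sum_e_pull F hF, map_neg, map_sub, map_smul, H.ρ_vecX]
  module

/-- Conformal covariance of the fermionic operators under inversion. -/
theorem ferm_pull (n : ℕ) (hm : 1 ≤ m) (F : Fin m → A) (hF : ∑ i, J.e i (F i) = 0) (j : Fin m) :
    K.ferm n (fun i => K.vecX (I.ρ (2 * n - m) (I.pull F i))) j =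
      -K.vecX (I.ρ (-(2 * n) - m - 2) (I.pull (J.ferm n F) j)) := by
  have hN : (m : ℝ) + 2 * n ≠ 0 := by
    have : (1 : ℝ) ≤ m := by exact_mod_cast hm
    have : (0 : ℝ) ≤ n := n.cast_nonneg
    linarith
  set N : ℝ := (m : ℝ) + 2 * n with hNdef
  set g := V.div F with hg
  set t : ℤ := -(2 * n) - m - 2 with ht
  set w := K.vecX (I.ρ (2 * n - m) (I.C (I.pair F))) with hw
  -- The leading term, with the errors from commuting `DΔ^n` with the coordinates inside and outside
  -- the pairing. The terms in `w` are matched by `-N • w` in `hdiv`.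
  have h1 : K.dir ((W.lap ^ n) (K.vecX (I.ρ (2 * n - m) (I.pull F j)))) =
      -K.vecX (I.ρ t (I.pull (fun i => J.dir ((V.lap ^ n) (F i))) j)) +
      (4 * n : ℝ) • W.x j (K.vecX (I.ρ t (I.C (J.dir ((V.lap ^ (n - 1)) g))))) -
      (2 : ℝ) • K.e j ((W.lap ^ n) w) -
      (4 * n : ℝ) • W.d j (K.dir ((W.lap ^ (n - 1)) w)) := by
    simp only [InversionAction.pull, map_sub, map_smul, ← I.x_ρ, K.vecX_x, H.dir_lap_pow_vecX_ρ_C,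
      K.dir_lap_pow_x, I.dir_lap_pow_pair J n F hF, map_add, map_neg]
    module
  have hdiv : W.div (fun i => K.vecX (I.ρ (2 * n - m) (I.pull F i))) =
      K.vecX (I.ρ (2 * n - m - 2) (I.C g)) - N • w := by
    rw [H.div_vecX_ρ_pull _ F hF, hNdef]
    push_cast
    module
  -- The weight `2n - m - 2 = 2(n-1) - m` is the one for which `DΔ^(n-1)` is covariant. The factor
  -- `n` covers `n = 0`, where `n - 1` is truncated.
  have h2 : (n : ℝ) • K.dir ((W.lap ^ (n - 1)) (K.vecX (I.ρ (2 * n - m - 2) (I.C g)))) =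
      -((n : ℝ) • K.vecX (I.ρ (t + 2) (I.C (J.dir ((V.lap ^ (n - 1)) g))))) := by
    rcases n with - | n
    · simp
    · have e1 : (2 * (n + 1 : ℕ) - m - 2 : ℤ) = 2 * n - m := by push_cast; ring
      have e2 : t + 2 = -(2 * n) - m - 2 := by rw [ht]; push_cast; ring
      rw [e1, e2, Nat.add_sub_cancel, H.dir_lap_pow_vecX_ρ_C, smul_neg]
  -- Here `Δ^n = -D(DΔ^(n-1))`: covariance handles the inner operator and `dir_vecX_ρ_C` the outer
  -- `D`.
  have h3 : (W.lap ^ n) (K.vecX (I.ρ (2 * n - m - 2) (I.C g))) =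
      (2 * n : ℝ) • I.ρ (t + 2) (I.C (J.dir ((V.lap ^ (n - 1)) g))) +
        K.vecX (I.ρ t (I.C ((V.lap ^ n) g))) := by
    rcases n with - | n
    · simp only [ht]
      simp
    · have e1 : (2 * (n + 1 : ℕ) - m - 2 : ℤ) = 2 * n - m := by push_cast; ring
      have e2 : t + 2 = -(2 * n) - m - 2 := by rw [ht]; push_cast; ring
      have e3 : t = -(2 * n) - m - 2 - 2 := by rw [ht]; push_cast; ring
      have h4 : ∀ f : B, W.lap f = -K.dir (K.dir f) := fun f => by rw [K.dir_dir, neg_neg]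
      rw [e1, Nat.add_sub_cancel, W.lap_pow_succ, h4, H.dir_lap_pow_vecX_ρ_C, map_neg, neg_neg,
        H.dir_vecX_ρ_C, J.dir_dir, ← V.lap_pow_succ, e2, e3]
      simp only [map_neg]
      push_cast
      module
  have hf : J.ferm n F = fun i => (J.dir ((V.lap ^ n) (F i)) -
      (2 / N) • J.e i ((V.lap ^ n) g)) - (4 * (n : ℝ) / N) •
        V.d i (J.dir ((V.lap ^ (n - 1)) g)) := by
    funext i
    rw [J.ferm_eq]
  have h6 : (4 * (n : ℝ) / N) • W.d j (K.dir ((W.lap ^ (n - 1))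
      (K.vecX (I.ρ (2 * n - m - 2) (I.C g))))) = -((4 * (n : ℝ) / N) •
        W.d j (K.vecX (I.ρ (t + 2) (I.C (J.dir ((V.lap ^ (n - 1)) g)))))) := by
    have := congrArg (fun v => (4 / N) • W.d j v) h2
    simp only [map_smul, map_neg, smul_smul, smul_neg] at this
    rw [show 4 * (n : ℝ) / N = 4 / N * n by ring, this]
  rw [hf, I.pull_sub, I.pull_sub, I.pull_smul, I.pull_smul, I.pull_d, K.ferm_eq, h1, hdiv,
    ← hNdef]
  simp only [map_sub, smul_sub]
  rw [h3, h6, K.d_vecX, I.d_ρ]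
  simp only [map_smul, map_add, I.ρ_ρ, ← H.ρ_vecX, H.vecX_pull_e, map_neg, ← H.ρ_e,
    K.vecX_x, ← I.x_ρ]
  have e1 : t + 2 - 2 = t := by ring
  -- Two cancellations are left: the `e_j` term of `h3` against the derivative of the factor `x`,
  -- and the `x_j` term of `h1` against the derivative of `|x|^(-N)`.
  have e3 : ((t + 2 : ℤ) : ℝ) = -N := by rw [hNdef, ht]; push_cast; ring
  rw [e1, e3]
  match_scalars <;> field_simp <;> ring

end CliffordInversion

/-! ### Covariance under similarities. -/

theorem WeylAction.bos_smul {m : ℕ} {N : Type*} [AddCommGroup N] [Module ℝ N]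
    (W : WeylAction m N) (n : ℕ) (r : ℝ) (F : Fin m → N) (j : Fin m) :
    W.bos n (fun i => r • F i) j = r • W.bos n F j := by
  simp only [WeylAction.bos, map_smul, W.div_smul]
  module

theorem CliffordAction.ferm_smul {m : ℕ} {N : Type*} [AddCommGroup N] [Module ℝ N]
    {W : WeylAction m N} (K : CliffordAction W) (n : ℕ) (r : ℝ) (F : Fin m → N) (j : Fin m) :
    K.ferm n (fun i => r • F i) j = r • K.ferm n F j := by
  simp only [CliffordAction.ferm, map_smul, W.div_smul]
  module

/-- The algebraic relations satisfied by composition `C` with an affine similarity with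
orthogonal part `R` and factor `t`. -/
structure SimilarityAction {m : ℕ} {A B : Type*} [AddCommGroup A] [Module ℝ A] [AddCommGroup B]
    [Module ℝ B] (V : WeylAction m A) (W : WeylAction m B) where
  C : A →ₗ[ℝ] B
  R : Fin m → Fin m → ℝ
  t : ℝ
  orth : ∀ i j, ∑ k, R i k * R j k = if i = j then 1 else 0
  d_C : ∀ j f, W.d j (C f) = t • ∑ i, R i j • C (V.d i f)

namespace SimilarityAction

variable {m : ℕ} {A B : Type*} [AddCommGroup A] [Module ℝ A] [AddCommGroup B] [Module ℝ B]
  {V : WeylAction m A} {W : WeylAction m B} (T : SimilarityAction V W)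

/-- The pullback of the components of a vector-valued function. -/
noncomputable def pull (F : Fin m → A) (j : Fin m) : B := ∑ i, T.R i j • T.C (F i)

theorem sum_orth (F : Fin m → B) (k : Fin m) : ∑ j, T.R k j • ∑ i, T.R i j • F i = F k := by
  simp only [Finset.smul_sum, smul_smul]
  rw [Finset.sum_comm]
  simp only [← Finset.sum_smul, T.orth, ite_smul, one_smul, zero_smul, Finset.sum_ite_eq,
    Finset.mem_univ, if_true]

theorem div_pull (F : Fin m → A) : W.div (T.pull F) = T.t • T.C (V.div F) := by
  simp only [WeylAction.div, pull, map_sum, map_smul, T.d_C]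
  rw [Finset.sum_comm, Finset.smul_sum]
  refine Finset.sum_congr rfl fun k _ => ?_
  rw [← T.sum_orth (fun i => T.C (V.d i (F k))) k, Finset.smul_sum]
  exact Finset.sum_congr rfl fun j _ => smul_comm _ _ _

theorem d_C' (j : Fin m) (f : A) : W.d j (T.C f) = T.t • T.pull (fun i => V.d i f) j :=
  T.d_C j f

theorem lap_C (f : A) : W.lap (T.C f) = T.t ^ 2 • T.C (V.lap f) := by
  have h2 : W.lap (T.C f) = W.div (fun i => W.d i (T.C f)) := by
    simp [WeylAction.div, W.lap_apply]
  have h3 : V.lap f = V.div (fun i => V.d i f) := by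
    simp [WeylAction.div, V.lap_apply]
  rw [h2, h3]
  simp only [T.d_C', W.div_smul, T.div_pull]
  module

theorem lap_pow_C (n : ℕ) (f : A) :
    (W.lap ^ n) (T.C f) = T.t ^ (2 * n) • T.C ((V.lap ^ n) f) := by
  induction n with
  | zero => simp
  | succ n ih =>
    rw [W.lap_pow_succ, ih, map_smul, T.lap_C, V.lap_pow_succ, smul_smul]
    ring_nf

theorem lap_pow_pull (n : ℕ) (F : Fin m → A) (j : Fin m) :
    (W.lap ^ n) (T.pull F j) = T.t ^ (2 * n) • T.pull (fun i => (V.lap ^ n) (F i)) j := by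
  simp only [pull, map_sum, map_smul, T.lap_pow_C, Finset.smul_sum, smul_comm (T.t ^ (2 * n))]

theorem pull_sub (F G : Fin m → A) (j : Fin m) :
    T.pull (fun i => F i - G i) j = T.pull F j - T.pull G j := by
  simp only [pull, map_sub, smul_sub, Finset.sum_sub_distrib]

theorem pull_smul (r : ℝ) (F : Fin m → A) (j : Fin m) :
    T.pull (fun i => r • F i) j = r • T.pull F j := by
  simp only [pull, map_smul, Finset.smul_sum, smul_comm r]

/-- Covariance of the bosonic operators under similarities. -/
theorem bos_pull {n : ℕ} (hn : 1 ≤ n) (F : Fin m → A) (j : Fin m) :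
    W.bos n (T.pull F) j = T.t ^ (2 * n) • T.pull (V.bos n F) j := by
  obtain ⟨n, rfl⟩ : ∃ k, n = k + 1 := ⟨n - 1, by omega⟩
  have h : V.bos (n + 1) F = fun i => (V.lap ^ (n + 1)) (F i) -
      (4 * ((n + 1 : ℕ) : ℝ) / ((m : ℝ) + 2 * (n + 1 : ℕ) - 2)) •
        V.d i (V.div fun i => (V.lap ^ n) (F i)) := rfl
  rw [h, T.pull_sub, T.pull_smul, WeylAction.bos]
  simp only [Nat.add_sub_cancel, T.lap_pow_pull, W.div_smul, T.div_pull, map_smul, T.d_C']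
  module

/-- In the application `γ` is left multiplication by `d̃` or `c̃`. The hypothesis says that a vector
passes it after rotation by `R`, up to the sign `s`; orthogonality then undoes the rotation. -/
theorem sum_smul_e {K : CliffordAction W} {γ : B →ₗ[ℝ] B} {s : ℝ}
    (e_γ : ∀ j f, K.e j (γ f) = s • ∑ i, T.R i j • γ (K.e i f)) (k : Fin m) (f : B) :
    ∑ j, T.R k j • K.e j (γ f) = s • γ (K.e k f) := by
  simp only [e_γ, smul_comm _ s, ← Finset.smul_sum]
  rw [T.sum_orth fun i => γ (K.e i f)]

theorem sum_e_pull {J : CliffordAction V} {K : CliffordAction W} {γ : B →ₗ[ℝ] B} {s : ℝ}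
    (C_e : ∀ i f, T.C (J.e i f) = K.e i (T.C f))
    (e_γ : ∀ j f, K.e j (γ f) = s • ∑ i, T.R i j • γ (K.e i f)) (F : Fin m → A)
    (hF : ∑ i, J.e i (F i) = 0) : ∑ j, K.e j (γ (T.pull F j)) = 0 := by
  simp only [pull, map_sum, map_smul]
  rw [Finset.sum_comm]
  simp only [T.sum_smul_e e_γ, ← C_e, ← Finset.smul_sum, ← map_sum, hF, map_zero, smul_zero]

/-- Covariance of the fermionic operators under similarities. -/
theorem ferm_pull {J : CliffordAction V} {K : CliffordAction W} {γ : B →ₗ[ℝ] B} {s : ℝ}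
    (C_e : ∀ i f, T.C (J.e i f) = K.e i (T.C f)) (d_γ : ∀ i f, W.d i (γ f) = γ (W.d i f))
    (e_γ : ∀ j f, K.e j (γ f) = s • ∑ i, T.R i j • γ (K.e i f))
    (n : ℕ) (F : Fin m → A) (j : Fin m) :
    K.ferm n (fun i => γ (T.pull F i)) j =
      (s * T.t ^ (2 * n + 1)) • γ (T.pull (J.ferm n F) j) := by
  have lap_γ : ∀ n f, (W.lap ^ n) (γ f) = γ ((W.lap ^ n) f) := fun n f => by
    induction n with
    | zero => simp
    | succ n ih => simp only [W.lap_pow_succ, ih, W.lap_apply, d_γ, map_sum]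
  have div_γ : ∀ G : Fin m → B, W.div (fun i => γ (G i)) = γ (W.div G) := fun G => by
    simp only [WeylAction.div, d_γ, map_sum]
  have dir_γ : ∀ f, K.dir (γ (T.C f)) = (s * T.t) • γ (T.C (J.dir f)) := fun f => by
    simp only [K.dir_apply, d_γ, T.d_C, map_smul, map_sum, J.dir_apply, C_e]
    rw [← Finset.smul_sum, Finset.sum_comm]
    simp only [T.sum_smul_e e_γ, ← Finset.smul_sum]
    module
  have dir_γ_pull : ∀ (G : Fin m → A) j, K.dir (γ (T.pull G j)) =
      (s * T.t) • γ (T.pull (fun i => J.dir (G i)) j) := fun G j => by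
    simp only [pull, map_sum, map_smul, dir_γ, Finset.smul_sum, smul_comm (s * T.t)]
  have e_γ_C : ∀ j f, K.e j (γ (T.C f)) = s • γ (T.pull (fun i => J.e i f) j) := fun j f => by
    simp only [e_γ, pull, C_e, map_sum, map_smul]
  have h : J.ferm n F = fun i => (J.dir ((V.lap ^ n) (F i)) -
      (2 / ((m : ℝ) + 2 * n)) • J.e i ((V.lap ^ n) (V.div F))) -
      (4 * (n : ℝ) / ((m : ℝ) + 2 * n)) • V.d i (J.dir ((V.lap ^ (n - 1)) (V.div F))) :=
    funext fun i => J.ferm_eq n F i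
  rw [h, T.pull_sub, T.pull_sub, T.pull_smul, T.pull_smul, K.ferm_eq]
  -- The factor `n` is kept so that the truncated exponent `n - 1` does no harm at `n = 0`.
  have hn : ∀ f, (n : ℝ) • W.d j (K.dir ((W.lap ^ (n - 1)) (T.t • γ (T.C f)))) =
      (n * (s * T.t ^ (2 * n + 1))) •
        γ (T.pull (fun i => V.d i (J.dir ((V.lap ^ (n - 1)) f))) j) := fun f => by
    rcases n with - | n
    · simp
    · simp only [Nat.add_sub_cancel, map_smul, lap_γ, T.lap_pow_C, dir_γ, d_γ, T.d_C']
      module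
  have hn' : ∀ f, (4 * (n : ℝ) / ((m : ℝ) + 2 * n)) •
      W.d j (K.dir ((W.lap ^ (n - 1)) (T.t • γ (T.C f)))) = (4 / ((m : ℝ) + 2 * n)) •
        ((n : ℝ) • W.d j (K.dir ((W.lap ^ (n - 1)) (T.t • γ (T.C f))))) := fun f => by
    rw [smul_smul]; ring_nf
  have hg : W.div (fun i => γ (T.pull F i)) = T.t • γ (T.C (V.div F)) := by
    rw [div_γ, T.div_pull, map_smul]
  rw [hg, hn', hn]
  simp only [lap_γ, T.lap_pow_pull, map_smul, dir_γ_pull, T.lap_pow_C, e_γ_C, map_sub]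
  module

end SimilarityAction

/-! ### Smooth functions on open sets as a model of the relations. -/

theorem inner_stdVec {m : ℕ} (x : Euc m) (i : Fin m) : inner ℝ (stdVec i) x = x i := by
  simp [stdVec, EuclideanSpace.inner_single_left]

theorem stdVec_apply {m : ℕ} (i j : Fin m) : stdVec i j = if j = i then (1 : ℝ) else 0 := by
  simp [stdVec]

theorem sum_smul_stdVec {m : ℕ} (x : Euc m) : ∑ i, x i • stdVec i = x := by
  ext j
  simp [stdVec_apply]

theorem ContinuousLinearMap.eq_sum_stdVec {m : ℕ} {V : Type*} [AddCommGroup V] [Module ℝ V]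
    [TopologicalSpace V] (L : Euc m →L[ℝ] V) (x : Euc m) : L x = ∑ i, x i • L (stdVec i) := by
  conv_lhs => rw [← sum_smul_stdVec x]
  simp

/-- Smooth functions on an open set, extended by zero. -/
def SmoothSpace {m : ℕ} (U : Opens (Euc m)) (V : Type*) [NormedAddCommGroup V]
    [NormedSpace ℝ V] : Submodule ℝ (Euc m → V) where
  carrier := {f | ContDiffOn ℝ ∞ f U ∧ ∀ x ∉ U, f x = 0}
  add_mem' hf hg := ⟨hf.1.add hg.1, fun x hx => by simp [hf.2 x hx, hg.2 x hx]⟩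
  zero_mem' := ⟨contDiffOn_const, fun _ _ => rfl⟩
  smul_mem' r f hf := ⟨hf.1.const_smul r, fun x hx => by simp [hf.2 x hx]⟩

namespace SmoothSpace

variable {m : ℕ} {U Ω : Opens (Euc m)} {V : Type*} [NormedAddCommGroup V] [NormedSpace ℝ V]

theorem contDiffOn (f : SmoothSpace U V) : ContDiffOn ℝ ∞ f.1 U := f.2.1

theorem contDiffAt (f : SmoothSpace U V) {x : Euc m} (hx : x ∈ U) : ContDiffAt ℝ ∞ f.1 x :=
  (contDiffOn f).contDiffAt (U.isOpen.mem_nhds hx)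

theorem differentiableAt (f : SmoothSpace U V) {x : Euc m} (hx : x ∈ U) :
    DifferentiableAt ℝ f.1 x :=
  (contDiffAt f hx).differentiableAt (by simp)

/-- Extension by zero makes equality on `U` an equality of elements, so pointwise identities become
identities of linear maps. -/
theorem ext_on {f g : SmoothSpace U V} (h : ∀ x ∈ U, f.1 x = g.1 x) : f = g := by
  ext x
  by_cases hx : x ∈ U
  · exact h x hx
  · rw [f.2.2 x hx, g.2.2 x hx]

/-- Restriction of a function which is smooth on `U`. -/
noncomputable def restrict (U : Opens (Euc m)) (f : Euc m → V) (hf : ContDiffOn ℝ ∞ f U) :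
    SmoothSpace U V :=
  ⟨(U : Set (Euc m)).indicator f, hf.congr fun _ hx => Set.indicator_of_mem hx f,
    fun _ hx => Set.indicator_of_notMem hx f⟩

theorem restrict_apply {f : Euc m → V} (hf : ContDiffOn ℝ ∞ f U) {x : Euc m} (hx : x ∈ U) :
    (restrict U f hf).1 x = f x := Set.indicator_of_mem hx f

theorem restrict_eventuallyEq {f : Euc m → V} (hf : ContDiffOn ℝ ∞ f U) {x : Euc m}
    (hx : x ∈ U) : (restrict U f hf).1 =ᶠ[nhds x] f :=
  Filter.eventually_of_mem (U.isOpen.mem_nhds hx) fun _ hy => restrict_apply hf hy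

/-- Build a linear map between spaces of smooth functions from its values. -/
noncomputable def mkLinear {V' : Type*} [NormedAddCommGroup V'] [NormedSpace ℝ V']
    (T : SmoothSpace Ω V → Euc m → V') (hT : ∀ f, ContDiffOn ℝ ∞ (T f) U)
    (add : ∀ f g, ∀ x ∈ U, T (f + g) x = T f x + T g x)
    (smul : ∀ (r : ℝ) f, ∀ x ∈ U, T (r • f) x = r • T f x) :
    SmoothSpace Ω V →ₗ[ℝ] SmoothSpace U V' where
  toFun f := restrict U (T f) (hT f)
  map_add' f g := ext_on fun x hx => by
    rw [restrict_apply _ hx, add f g x hx, Submodule.coe_add, Pi.add_apply,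
      restrict_apply _ hx, restrict_apply _ hx]
  map_smul' r f := ext_on fun x hx => by
    rw [restrict_apply _ hx, smul r f x hx, RingHom.id_apply, Submodule.coe_smul, Pi.smul_apply,
      restrict_apply _ hx]

section
variable {V' : Type*} [NormedAddCommGroup V'] [NormedSpace ℝ V']
  {T : SmoothSpace Ω V → Euc m → V'} {hT : ∀ f, ContDiffOn ℝ ∞ (T f) U}
  {add : ∀ f g, ∀ x ∈ U, T (f + g) x = T f x + T g x}
  {smul : ∀ (r : ℝ) f, ∀ x ∈ U, T (r • f) x = r • T f x}

theorem mkLinear_apply (f : SmoothSpace Ω V) {x : Euc m} (hx : x ∈ U) :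
    (mkLinear T hT add smul f).1 x = T f x := restrict_apply (hT f) hx

theorem mkLinear_eventuallyEq (f : SmoothSpace Ω V) {x : Euc m} (hx : x ∈ U) :
    (mkLinear T hT add smul f).1 =ᶠ[nhds x] T f := restrict_eventuallyEq (hT f) hx

end

theorem contDiffOn_fderiv (f : SmoothSpace U V) : ContDiffOn ℝ ∞ (fderiv ℝ f.1) U :=
  (contDiffOn f).fderiv_of_isOpen U.isOpen (by simp)

/-- Partial derivatives. -/
noncomputable def pd (i : Fin m) : SmoothSpace U V →ₗ[ℝ] SmoothSpace U V :=
  mkLinear (fun f x => fderiv ℝ f.1 x (stdVec i))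
    (fun f => (contDiffOn_fderiv f).clm_apply contDiffOn_const)
    (fun f g x hx => by
      rw [Submodule.coe_add, fderiv_add (differentiableAt f hx) (differentiableAt g hx)]; rfl)
    (fun r f x hx => by
      rw [Submodule.coe_smul, fderiv_const_smul (differentiableAt f hx)]; rfl)

theorem pd_apply (i : Fin m) (f : SmoothSpace U V) {x : Euc m} (hx : x ∈ U) :
    (pd i f).1 x = fderiv ℝ f.1 x (stdVec i) := mkLinear_apply _ hx

theorem pd_eventuallyEq (i : Fin m) (f : SmoothSpace U V) {x : Euc m} (hx : x ∈ U) :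
    (pd i f).1 =ᶠ[nhds x] fun y => fderiv ℝ f.1 y (stdVec i) := mkLinear_eventuallyEq _ hx

theorem pd_comm (i j : Fin m) (f : SmoothSpace U V) : pd i (pd j f) = pd j (pd i f) := by
  refine ext_on fun x hx => ?_
  have h : ∀ i j : Fin m, (pd i (pd j f)).1 x =
      fderiv ℝ (fderiv ℝ f.1) x (stdVec i) (stdVec j) := fun i j => by
    rw [pd_apply _ _ hx, (pd_eventuallyEq j f hx).fderiv_eq,
      fderiv_clm_apply (((contDiffOn_fderiv f).contDiffAt (U.isOpen.mem_nhds hx)).differentiableAt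
        (by simp)) (differentiableAt_const _)]
    simp
  rw [h, h]
  exact ((contDiffAt f hx).isSymmSndFDerivAt
    (by simpa using (WithTop.coe_le_coe.2 le_top : ((2 : ℕ∞) : WithTop ℕ∞) ≤ ∞))) _ _

/-- Multiplication by a smooth real function. -/
noncomputable def mulReal (a : Euc m → ℝ) (ha : ContDiffOn ℝ ∞ a U) :
    SmoothSpace U V →ₗ[ℝ] SmoothSpace U V :=
  mkLinear (fun f x => a x • f.1 x) (fun f => ha.smul (contDiffOn f))
    (fun f g x _ => by simp) (fun r f x _ => smul_comm _ _ _)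

theorem mulReal_apply {a : Euc m → ℝ} (ha : ContDiffOn ℝ ∞ a U) (f : SmoothSpace U V)
    {x : Euc m} (hx : x ∈ U) : (mulReal a ha f).1 x = a x • f.1 x := mkLinear_apply _ hx

theorem pd_mulReal {a : Euc m → ℝ} (ha : ContDiffOn ℝ ∞ a U) (i : Fin m) (f : SmoothSpace U V)
    {x : Euc m} (hx : x ∈ U) : (pd i (mulReal a ha f)).1 x =
      a x • (pd i f).1 x + fderiv ℝ a x (stdVec i) • f.1 x := by
  have h : (mulReal a ha f).1 =ᶠ[nhds x] fun y => a y • f.1 y := mkLinear_eventuallyEq _ hx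
  rw [pd_apply _ _ hx, h.fderiv_eq, fderiv_fun_smul
    ((ha.contDiffAt (U.isOpen.mem_nhds hx)).differentiableAt (by simp)) (differentiableAt f hx),
    pd_apply _ _ hx]
  simp

/-- Pointwise application of a continuous linear map. -/
noncomputable def map (L : V →L[ℝ] V) : SmoothSpace U V →ₗ[ℝ] SmoothSpace U V :=
  mkLinear (fun f x => L (f.1 x)) (fun f => L.contDiff.comp_contDiffOn (contDiffOn f))
    (fun f g x _ => by simp) (fun r f x _ => by simp)

theorem map_apply (L : V →L[ℝ] V) (f : SmoothSpace U V) {x : Euc m} (hx : x ∈ U) :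
    (map L f).1 x = L (f.1 x) := mkLinear_apply _ hx

theorem pd_map (L : V →L[ℝ] V) (i : Fin m) (f : SmoothSpace U V) :
    pd i (map L f) = map L (pd i f) := by
  refine ext_on fun x hx => ?_
  have h : (map L f).1 =ᶠ[nhds x] fun y => L (f.1 y) := mkLinear_eventuallyEq _ hx
  rw [pd_apply _ _ hx, h.fderiv_eq, map_apply _ _ hx, pd_apply _ _ hx]
  have := (L.hasFDerivAt.comp x (differentiableAt f hx).hasFDerivAt).fderiv
  simp only [Function.comp_def] at this
  rw [this]; rfl

theorem mulReal_map {a : Euc m → ℝ} (ha : ContDiffOn ℝ ∞ a U) (L : V →L[ℝ] V)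
    (f : SmoothSpace U V) : mulReal a ha (map L f) = map L (mulReal a ha f) :=
  ext_on fun x hx => by
    rw [mulReal_apply _ _ hx, map_apply _ _ hx, map_apply _ _ hx, mulReal_apply _ _ hx,
      L.map_smul]

/-- Composition with a smooth map. -/
noncomputable def comp (φ : Euc m → Euc m) (hφ : ContDiffOn ℝ ∞ φ U)
    (hU : ∀ x ∈ U, φ x ∈ Ω) : SmoothSpace Ω V →ₗ[ℝ] SmoothSpace U V :=
  mkLinear (fun f x => f.1 (φ x)) (fun f => (contDiffOn f).comp hφ hU)
    (fun f g x _ => by simp) (fun r f x _ => by simp)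

theorem comp_apply {φ : Euc m → Euc m} (hφ : ContDiffOn ℝ ∞ φ U) (hU : ∀ x ∈ U, φ x ∈ Ω)
    (f : SmoothSpace Ω V) {x : Euc m} (hx : x ∈ U) : (comp φ hφ hU f).1 x = f.1 (φ x) :=
  mkLinear_apply _ hx

theorem pd_comp {φ : Euc m → Euc m} (hφ : ContDiffOn ℝ ∞ φ U) (hU : ∀ x ∈ U, φ x ∈ Ω)
    (f : SmoothSpace Ω V) (i : Fin m) {x : Euc m} (hx : x ∈ U) :
    (pd i (comp φ hφ hU f)).1 x = fderiv ℝ f.1 (φ x) (fderiv ℝ φ x (stdVec i)) := by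
  have h : (comp φ hφ hU f).1 =ᶠ[nhds x] f.1 ∘ φ := mkLinear_eventuallyEq _ hx
  rw [pd_apply _ _ hx, h.fderiv_eq, fderiv_comp x (differentiableAt f (hU x hx))
    ((hφ.contDiffAt (U.isOpen.mem_nhds hx)).differentiableAt (by simp))]
  rfl

theorem comp_map {φ : Euc m → Euc m} (hφ : ContDiffOn ℝ ∞ φ U) (hU : ∀ x ∈ U, φ x ∈ Ω)
    (L : V →L[ℝ] V) (f : SmoothSpace Ω V) :
    comp φ hφ hU (map L f) = map L (comp φ hφ hU f) :=
  ext_on fun x hx => by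
    rw [comp_apply _ _ _ hx, map_apply _ _ (hU x hx), map_apply _ _ hx, comp_apply _ _ _ hx]

theorem sum_apply {ι : Type*} (s : Finset ι) (F : ι → SmoothSpace U V) (x : Euc m) :
    (∑ i ∈ s, F i).1 x = ∑ i ∈ s, (F i).1 x := by
  rw [AddSubmonoidClass.coe_finsetSum, Finset.sum_apply]

theorem contDiff_coord (v : Euc m) (i : Fin m) : ContDiff ℝ ∞ fun x : Euc m => (x + v) i := by
  have : (fun x : Euc m => (x + v) i) = fun x => inner ℝ (stdVec i) (x + v) :=
    funext fun x => (inner_stdVec _ _).symm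
  rw [this]
  exact contDiff_const.inner ℝ (contDiff_id.add contDiff_const)

theorem fderiv_coord (v : Euc m) (i j : Fin m) (x : Euc m) :
    fderiv ℝ (fun x : Euc m => (x + v) i) x (stdVec j) = if j = i then 1 else 0 := by
  have : (fun x : Euc m => (x + v) i) = fun x => innerSL ℝ (stdVec i) (x + v) :=
    funext fun x => (inner_stdVec _ _).symm
  have h := ((innerSL ℝ (stdVec i)).hasFDerivAt.comp x
    ((hasFDerivAt_id x).add_const v)).fderiv
  simp only [Function.comp_def, id] at h
  rw [this, h]
  simp [inner_stdVec, stdVec_apply, eq_comm]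

/-- Partial derivatives and multiplications by the coordinates of `x + v`. -/
noncomputable def weyl (U : Opens (Euc m)) (V : Type*) [NormedAddCommGroup V] [NormedSpace ℝ V]
    (v : Euc m) : WeylAction m (SmoothSpace U V) where
  d := pd
  x i := mulReal (fun x => (x + v) i) (contDiff_coord v i).contDiffOn
  d_comm := pd_comm
  x_comm i j f := ext_on fun x hx => by
    simp only [mulReal_apply _ _ hx]; exact smul_comm _ _ _
  d_x i j f := ext_on fun x hx => by
    rw [pd_mulReal _ _ _ hx, fderiv_coord, Submodule.coe_add, Pi.add_apply,
      mulReal_apply _ _ hx]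
    split_ifs <;> simp

theorem weyl_x_apply (v : Euc m) (i : Fin m) (f : SmoothSpace U V) {x : Euc m} (hx : x ∈ U) :
    ((weyl U V v).x i f).1 x = (x + v) i • f.1 x  :=
  mulReal_apply (contDiff_coord v i).contDiffOn _ hx

theorem euler_zero_apply (f : SmoothSpace U V) {x : Euc m} (hx : x ∈ U) :
    ((weyl U V 0).euler f).1 x = fderiv ℝ f.1 x x := by
  rw [WeylAction.euler_apply, sum_apply, ContinuousLinearMap.eq_sum_stdVec]
  refine Finset.sum_congr rfl fun i _ => ?_
  rw [weyl_x_apply _ _ _ hx, add_zero]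
  congr 1
  exact pd_apply _ _ hx

end SmoothSpace

theorem contDiffAt_norm_add_zpow {m : ℕ} (v : Euc m) (k : ℤ) {x : Euc m} (hx : x + v ≠ 0) :
    ContDiffAt ℝ ∞ (fun x => ‖x + v‖ ^ k) x := by
  have h : ContDiffAt ℝ ∞ (fun x => ‖x + v‖) x :=
    (contDiffAt_id.add contDiffAt_const).norm ℝ hx
  have h0 : ‖x + v‖ ≠ 0 := norm_ne_zero_iff.2 hx
  rcases k with k | k
  · simpa using h.pow k
  · simp only [zpow_negSucc]
    exact (h.pow (k + 1)).inv (pow_ne_zero _ h0)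

theorem fderiv_norm_add_zpow {m : ℕ} (v : Euc m) (k : ℤ) {x : Euc m} (hx : x + v ≠ 0)
    (u : Euc m) : fderiv ℝ (fun x => ‖x + v‖ ^ k) x u =
      k * ‖x + v‖ ^ (k - 2) * inner ℝ (x + v) u := by
  have h0 : ‖x + v‖ ≠ 0 := norm_ne_zero_iff.2 hx
  -- The norm is differentiated as the square root of its square, which does not vanish here.
  have h1 : HasFDerivAt (fun x => ‖x + v‖ ^ 2) (2 • innerSL ℝ (x + v)) x := by
    have := ((hasFDerivAt_id (𝕜 := ℝ) x).add_const v).norm_sq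
    simpa using this
  have h2 := h1.sqrt (pow_ne_zero 2 h0)
  simp only [Real.sqrt_sq (norm_nonneg _)] at h2
  have h3 := (hasDerivAt_zpow k ‖x + v‖ (Or.inl h0)).comp_hasFDerivAt x h2
  simp only [Function.comp_def] at h3
  rw [h3.fderiv, show k - 2 = k - 1 - 1 by ring, zpow_sub_one₀ h0 (k - 1)]
  simp only [smul_apply, smul_eq_mul, innerSL_apply_apply, nsmul_eq_mul]
  push_cast
  field_simp

/-- The inversion `x ↦ (x + v) / ‖x + v‖²` with centre `-v`. -/
noncomputable def inversionAt {m : ℕ} (v x : Euc m) : Euc m := ‖x + v‖ ^ (-2 : ℤ) • (x + v)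

theorem contDiffAt_inversionAt {m : ℕ} (v : Euc m) {x : Euc m} (hx : x + v ≠ 0) :
    ContDiffAt ℝ ∞ (inversionAt v) x :=
  (contDiffAt_norm_add_zpow v (-2) hx).smul (contDiffAt_id.add contDiffAt_const)

theorem fderiv_inversionAt {m : ℕ} (v : Euc m) {x : Euc m} (hx : x + v ≠ 0) (u : Euc m) :
    fderiv ℝ (inversionAt v) x u = ‖x + v‖ ^ (-2 : ℤ) • u -
      (2 * ‖x + v‖ ^ (-2 : ℤ) * inner ℝ (x + v) u) • inversionAt v x := by
  have h0 : ‖x + v‖ ≠ 0 := norm_ne_zero_iff.2 hx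
  have h := fderiv_smul ((contDiffAt_norm_add_zpow v (-2) hx).differentiableAt (by simp))
    (((hasFDerivAt_id (𝕜 := ℝ) x).add_const v).differentiableAt)
  have h' : inversionAt v = (fun x => ‖x + v‖ ^ (-2 : ℤ)) • fun x => id x + v := rfl
  rw [h', h, ((hasFDerivAt_id (𝕜 := ℝ) x).add_const v).fderiv]
  simp only [add_apply, smul_apply,
    ContinuousLinearMap.smulRight_apply, fderiv_norm_add_zpow v _ hx, id,
    ContinuousLinearMap.id_apply, Pi.smul_apply', smul_smul]
  rw [show (-2 - 2 : ℤ) = -2 + -2 by norm_num, zpow_add₀ h0]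
  push_cast
  module

namespace SmoothSpace

variable {m : ℕ} {U Ω : Opens (Euc m)} {V : Type*} [NormedAddCommGroup V] [NormedSpace ℝ V]

theorem contDiffOn_norm_add_zpow {v : Euc m} (h0 : ∀ x ∈ U, x + v ≠ 0) (k : ℤ) :
    ContDiffOn ℝ ∞ (fun x => ‖x + v‖ ^ k) U :=
  fun x hx => (contDiffAt_norm_add_zpow v k (h0 x hx)).contDiffWithinAt

theorem contDiffOn_inversionAt {v : Euc m} (h0 : ∀ x ∈ U, x + v ≠ 0) :
    ContDiffOn ℝ ∞ (inversionAt v) U :=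
  fun x hx => (contDiffAt_inversionAt v (h0 x hx)).contDiffWithinAt

theorem contDiff_similarity (R : Euc m ≃ₗᵢ[ℝ] Euc m) (t : ℝ) (e : Euc m) :
    ContDiff ℝ ∞ fun x => e + t • R x :=
  contDiff_const.add (R.contDiff.const_smul t)

/-- Composition with the inversion with centre `-v`. -/
noncomputable def inversion (V : Type*) [NormedAddCommGroup V] [NormedSpace ℝ V] (v : Euc m)
    (h0 : ∀ x ∈ U, x + v ≠ 0) (hU : ∀ x ∈ U, inversionAt v x ∈ Ω) :
    InversionAction (weyl Ω V 0) (weyl U V v) where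
  C := comp (inversionAt v) (contDiffOn_inversionAt h0) hU
  ρ k := mulReal (fun x => ‖x + v‖ ^ k) (contDiffOn_norm_add_zpow h0 k)
  ρ_ρ k l f := ext_on fun x hx => by
    simp only [mulReal_apply _ _ hx, smul_smul, zpow_add₀ (norm_ne_zero_iff.2 (h0 x hx))]
  ρ_zero f := ext_on fun x hx => by simp [mulReal_apply _ _ hx]
  ρ_two f := ext_on fun x hx => by
    simp only [sum_apply, weyl_x_apply _ _ _ hx, mulReal_apply _ _ hx, smul_smul,
      ← Finset.sum_smul]
    congr 1
    rw [zpow_ofNat, EuclideanSpace.real_norm_sq_eq]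
    exact Finset.sum_congr rfl fun i _ => (sq _).symm
  x_ρ k i f := ext_on fun x hx => by
    simp only [weyl_x_apply _ _ _ hx, mulReal_apply _ _ hx]; exact smul_comm _ _ _
  d_ρ k i f := ext_on fun x hx => by
    refine (pd_mulReal _ i f hx).trans ?_
    rw [fderiv_norm_add_zpow v k (h0 x hx), Submodule.coe_add, Pi.add_apply, Submodule.coe_smul,
      Pi.smul_apply, mulReal_apply _ _ hx, mulReal_apply _ _ hx, weyl_x_apply _ _ _ hx,
      real_inner_comm, inner_stdVec, smul_smul, smul_smul]
    rfl
  d_C i f := ext_on fun x hx => by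
    refine (pd_comp _ hU f i hx).trans ?_
    rw [fderiv_inversionAt v (h0 x hx), map_sub, map_smul, map_smul,
      ← euler_zero_apply f (hU x hx), real_inner_comm, inner_stdVec, Submodule.coe_sub,
      Pi.sub_apply, Submodule.coe_smul, Pi.smul_apply, mulReal_apply _ _ hx,
      mulReal_apply _ _ hx, weyl_x_apply _ _ _ hx, comp_apply _ _ _ hx, comp_apply _ _ _ hx,
      smul_smul, smul_smul, mul_assoc]
    congr 2
    exact (pd_apply i f (hU x hx)).symm
  C_x i f := ext_on fun x hx => by
    rw [comp_apply _ _ _ hx, weyl_x_apply _ _ _ (hU x hx), mulReal_apply _ _ hx,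
      weyl_x_apply _ _ _ hx, comp_apply _ _ _ hx, smul_smul,
      add_zero]
    rfl

theorem inversion_C_apply (v : Euc m) (h0 : ∀ x ∈ U, x + v ≠ 0)
    (hU : ∀ x ∈ U, inversionAt v x ∈ Ω) (f : SmoothSpace Ω V) {x : Euc m} (hx : x ∈ U) :
    ((inversion V v h0 hU).C f).1 x = f.1 (inversionAt v x) :=
  comp_apply (contDiffOn_inversionAt h0) hU _ hx

theorem inversion_ρ_apply (v : Euc m) (h0 : ∀ x ∈ U, x + v ≠ 0)
    (hU : ∀ x ∈ U, inversionAt v x ∈ Ω) (k : ℤ) (f : SmoothSpace U V) {x : Euc m} (hx : x ∈ U) :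
    ((inversion V v h0 hU).ρ k f).1 x = ‖x + v‖ ^ k • f.1 x :=
  mulReal_apply (contDiffOn_norm_add_zpow h0 k) _ hx

/-- The linear reflection in the hyperplane orthogonal to `z`. -/
noncomputable def _root_.reflectAt (z u : Euc m) : Euc m :=
  u - (2 * ‖z‖ ^ (-2 : ℤ) * inner ℝ z u) • z

/-- The reflection matrix is symmetric, so it may act on the components or on `u`. -/
theorem inversion_pull_apply (v : Euc m) (h0 : ∀ x ∈ U, x + v ≠ 0)
    (hU : ∀ x ∈ U, inversionAt v x ∈ Ω) (F : Fin m → SmoothSpace Ω V) {x : Euc m} (hx : x ∈ U)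
    (u : Euc m) : ∑ j, u j • ((inversion V v h0 hU).pull F j).1 x =
      ∑ j, reflectAt (x + v) u j • (F j).1 (inversionAt v x) := by
  have h : ∀ j, ((inversion V v h0 hU).pull F j).1 x = (F j).1 (inversionAt v x) -
      (2 * (x + v) j) • ∑ i, inversionAt v x i • (F i).1 (inversionAt v x) := fun j => by
    rw [InversionAction.pull, Submodule.coe_sub, Pi.sub_apply, Submodule.coe_smul, Pi.smul_apply,
      weyl_x_apply _ _ _ hx, inversion_C_apply _ _ _ _ hx, inversion_C_apply _ _ _ _ hx,
      InversionAction.pair, sum_apply, smul_smul]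
    congr 2
    exact Finset.sum_congr rfl fun i _ => by rw [weyl_x_apply _ _ _ (hU x hx), add_zero]
  simp only [h, smul_sub, Finset.sum_sub_distrib, reflectAt, PiLp.sub_apply, sub_smul,
    smul_smul, ← Finset.sum_smul, PiLp.smul_apply, smul_eq_mul]
  congr 1
  rw [Finset.smul_sum]
  refine Finset.sum_congr rfl fun i _ => ?_
  rw [smul_smul]
  congr 1
  simp only [inversionAt, PiLp.smul_apply, smul_eq_mul]
  rw [PiLp.inner_apply, Finset.mul_sum, Finset.sum_mul, Finset.sum_mul]
  refine Finset.sum_congr rfl fun j _ => ?_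
  simp
  ring

/-- Composition with the similarity `x ↦ e + t • R x`. -/
noncomputable def similarity (V : Type*) [NormedAddCommGroup V] [NormedSpace ℝ V]
    (R : Euc m ≃ₗᵢ[ℝ] Euc m) (t : ℝ) (e : Euc m) (hU : ∀ x ∈ U, e + t • R x ∈ Ω) (v : Euc m) :
    SimilarityAction (weyl Ω V 0) (weyl U V v) where
  C := comp (fun x => e + t • R x) (contDiff_similarity R t e).contDiffOn hU
  R i j := R (stdVec j) i
  t := t
  orth i j := by
    -- The inverse of an isometry has the transposed matrix, so orthonormality of the rows of `R` is
    -- that of the images of the basis under `R.symm`.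
    have h : ∀ i k, R (stdVec k) i = R.symm (stdVec i) k := fun i k => by
      rw [← inner_stdVec, ← inner_stdVec, real_inner_comm, ← R.symm.inner_map_map,
        R.symm_apply_apply]
    have h2 := R.symm.inner_map_map (stdVec i) (stdVec j)
    rw [inner_stdVec, stdVec_apply, PiLp.inner_apply] at h2
    rw [← h2]
    simp [h, mul_comm]
  d_C j f := ext_on fun x hx => by
    refine (pd_comp _ hU f j hx).trans ?_
    have h : HasFDerivAt (fun x => e + t • R x)
        (t • (R.toContinuousLinearEquiv : Euc m →L[ℝ] Euc m)) x :=
      (R.toContinuousLinearEquiv.hasFDerivAt.const_smul t).const_add e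
    rw [h.fderiv, Submodule.coe_smul, Pi.smul_apply, sum_apply]
    simp only [smul_apply, map_smul]
    rw [ContinuousLinearMap.eq_sum_stdVec]
    congr 1
    refine Finset.sum_congr rfl fun i _ => ?_
    rw [Submodule.coe_smul, Pi.smul_apply, comp_apply _ _ _ hx]
    congr 1
    exact (pd_apply i f (hU x hx)).symm

theorem similarity_C_apply (R : Euc m ≃ₗᵢ[ℝ] Euc m) (t : ℝ) (e : Euc m)
    (hU : ∀ x ∈ U, e + t • R x ∈ Ω) (v : Euc m) (f : SmoothSpace Ω V) {x : Euc m} (hx : x ∈ U) :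
    ((similarity V R t e hU v).C f).1 x = f.1 (e + t • R x) :=
  comp_apply (contDiff_similarity R t e).contDiffOn hU _ hx

theorem similarity_pull_apply (R : Euc m ≃ₗᵢ[ℝ] Euc m) (t : ℝ) (e : Euc m)
    (hU : ∀ x ∈ U, e + t • R x ∈ Ω) (v : Euc m) (F : Fin m → SmoothSpace Ω V) {x : Euc m}
    (hx : x ∈ U) (u : Euc m) : ∑ j, u j • ((similarity V R t e hU v).pull F j).1 x =
      ∑ j, R u j • (F j).1 (e + t • R x) := by
  have h : ∀ i, R u i = ∑ j, u j * R (stdVec j) i := fun i => by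
    conv_lhs => rw [← sum_smul_stdVec u]
    simp
  simp only [SimilarityAction.pull, sum_apply, Submodule.coe_smul, Pi.smul_apply,
    similarity_C_apply _ _ _ _ _ _ hx, h, Finset.sum_smul, Finset.smul_sum, smul_smul]
  rw [Finset.sum_comm]
  rfl

end SmoothSpace

/-! ### Operators in `(x, u)` as operators on components. -/

theorem laplacian_eq_sum {m : ℕ} {V : Type*} [NormedAddCommGroup V] [NormedSpace ℝ V]
    (g : Euc m → V) (x : Euc m) : Laplacian.laplacian g x =
      ∑ i, fderiv ℝ (fderiv ℝ g) x (stdVec i) (stdVec i) := by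
  rw [InnerProductSpace.laplacian_eq_iteratedFDeriv_orthonormalBasis g
    (EuclideanSpace.basisFun (Fin m) ℝ)]
  simp [iteratedFDeriv_two_apply, stdVec]

namespace SmoothSpace

variable {m : ℕ} {U : Opens (Euc m)} {V : Type} [NormedAddCommGroup V] [NormedSpace ℝ V]

theorem lap_apply (v : Euc m) (F : SmoothSpace U V) {x : Euc m} (hx : x ∈ U) :
    ((weyl U V v).lap F).1 x = Laplacian.laplacian F.1 x := by
  rw [WeylAction.lap_apply, sum_apply, laplacian_eq_sum]
  refine Finset.sum_congr rfl fun i _ => ?_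
  refine (pd_apply i (pd i F) hx).trans ?_
  rw [(pd_eventuallyEq i F hx).fderiv_eq,
    fderiv_clm_apply (((contDiffOn_fderiv F).contDiffAt (U.isOpen.mem_nhds hx)).differentiableAt
      (by simp)) (differentiableAt_const _)]
  simp

/-- The linear combination of smooth functions with coefficients `u`. -/
noncomputable def combine (F : Fin m → SmoothSpace U V) (u : Euc m) : SmoothSpace U V :=
  ∑ j, u j • F j

theorem combine_apply (F : Fin m → SmoothSpace U V) (u x : Euc m) :
    (combine F u).1 x = ∑ j, u j • (F j).1 x := by
  simp [combine, sum_apply]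

/-- `F` is the family of components of `f` on `U`. -/
def IsComponents (F : Fin m → SmoothSpace U V) (f : Euc m → Euc m → V) : Prop :=
  ∀ x ∈ U, ∀ u, f x u = (combine F u).1 x

theorem IsComponents.eventuallyEq {F : Fin m → SmoothSpace U V} {f : Euc m → Euc m → V}
    (h : IsComponents F f) {x : Euc m} (hx : x ∈ U) (u : Euc m) :
    (fun y => f y u) =ᶠ[nhds x] (combine F u).1 :=
  Filter.eventually_of_mem (U.isOpen.mem_nhds hx) fun y hy => h y hy u

theorem map_combine {T : SmoothSpace U V →ₗ[ℝ] SmoothSpace U V} (F : Fin m → SmoothSpace U V)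
    (u : Euc m) : T (combine F u) = combine (fun j => T (F j)) u := by
  simp [combine]

theorem IsComponents.laplaceX {F : Fin m → SmoothSpace U V} {f : Euc m → Euc m → V}
    (h : IsComponents F f) (v : Euc m) :
    IsComponents (fun j => (weyl U V v).lap (F j)) (laplaceX f) := fun x hx u => by
  rw [← map_combine, lap_apply _ _ hx]
  exact (InnerProductSpace.laplacian_congr_nhds (h.eventuallyEq hx u)).eq_of_nhds

theorem IsComponents.laplaceX_iterate {F : Fin m → SmoothSpace U V} {f : Euc m → Euc m → V}
    (h : IsComponents F f) (v : Euc m) (n : ℕ) :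
    IsComponents (fun j => ((weyl U V v).lap ^ n) (F j)) (_root_.laplaceX^[n] f) := by
  induction n with
  | zero => exact h
  | succ n ih =>
    rw [Function.iterate_succ_apply']
    simp only [WeylAction.lap_pow_succ]
    exact ih.laplaceX v

theorem IsComponents.partialX {F : Fin m → SmoothSpace U V} {f : Euc m → Euc m → V}
    (h : IsComponents F f) (v : Euc m) (i : Fin m) :
    IsComponents (fun j => (weyl U V v).d i (F j)) (partialX i f) := fun x hx u => by
  rw [← map_combine]
  refine Eq.trans ?_ (pd_apply i _ hx).symm
  rw [_root_.partialX, (h.eventuallyEq hx u).fderiv_eq]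

theorem fderiv_combination (c : Fin m → V) (u w : Euc m) :
    fderiv ℝ (fun u : Euc m => ∑ j, u j • c j) u w = ∑ j, w j • c j := by
  have h : (fun u : Euc m => ∑ j, u j • c j) =
      ⇑(∑ j, (innerSL ℝ (stdVec j)).smulRight (c j)) := by
    funext u
    simp [inner_stdVec]
  rw [h, ContinuousLinearMap.fderiv]
  simp [inner_stdVec]

/-- Differentiating a linear form in `u` extracts its coefficient. The result no longer depends on
`u`, as `innerUDx_apply` requires. -/
theorem IsComponents.innerDuDx {F : Fin m → SmoothSpace U V} {f : Euc m → Euc m → V}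
    (h : IsComponents F f) (v : Euc m) {x : Euc m} (hx : x ∈ U) (u : Euc m) :
    innerDuDx f x u = ((weyl U V v).div F).1 x := by
  rw [_root_.innerDuDx, WeylAction.div, sum_apply]
  refine Finset.sum_congr rfl fun i _ => ?_
  have h1 : _root_.partialX i f x = fun u => ∑ j, u j • ((weyl U V v).d i (F j)).1 x :=
    funext fun u => ((h.partialX v i) x hx u).trans (combine_apply _ _ _)
  rw [partialU, h1, fderiv_combination]
  simp [stdVec_apply]

theorem innerUDx_apply {f : Euc m → Euc m → V} {F : SmoothSpace U V}
    (h : ∀ x ∈ U, ∀ u, f x u = F.1 x) (v : Euc m) :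
    IsComponents (fun j => (weyl U V v).d j F) (innerUDx f) := fun x hx u => by
  rw [innerUDx, combine_apply]
  refine Finset.sum_congr rfl fun i _ => ?_
  congr 1
  refine Eq.trans ?_ (pd_apply i _ hx).symm
  have : (fun y => f y u) =ᶠ[nhds x] F.1 :=
    Filter.eventually_of_mem (U.isOpen.mem_nhds hx) fun y hy => h y hy u
  rw [partialX, this.fderiv_eq]

theorem IsComponents.bosonicOp {F : Fin m → SmoothSpace U V} {f : Euc m → Euc m → V}
    (h : IsComponents F f) (v : Euc m) (n : ℕ) :
    IsComponents ((weyl U V v).bos n F) (bosonicOp n f) := fun x hx u => by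
  have h1 := (h.laplaceX_iterate v n) x hx u
  have h2 := innerUDx_apply (fun x hx u => (h.laplaceX_iterate v (n - 1)).innerDuDx v hx u) v x hx u
  rw [_root_.bosonicOp, h1, h2]
  simp only [combine_apply, WeylAction.bos, Submodule.coe_sub, Pi.sub_apply, Submodule.coe_smul,
    Pi.smul_apply, smul_sub, Finset.sum_sub_distrib, Finset.smul_sum, smul_comm (_ / _ : ℝ)]

/-- The components of a function which is linear in the second variable. -/
noncomputable def components (f : Euc m → Euc m → V)
    (hf : ∀ u, ContDiffOn ℝ ∞ (fun x => f x u) U) (j : Fin m) : SmoothSpace U V :=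
  restrict U (fun x => f x (stdVec j)) (hf _)

theorem isComponents_components {f : Euc m → Euc m → V}
    (hf : ∀ u, ContDiffOn ℝ ∞ (fun x => f x u) U) (h : ∀ x ∈ U, IsHomogDegOne (f x)) :
    IsComponents (components f hf) f := fun x hx u => by
  obtain ⟨c, hc⟩ := h x hx
  rw [combine_apply, hc]
  refine Finset.sum_congr rfl fun j _ => ?_
  rw [components, restrict_apply _ hx, hc]
  simp [stdVec_apply]

theorem IsComponents.isHomogDegOne {F : Fin m → SmoothSpace U V} {f : Euc m → Euc m → V}
    (h : IsComponents F f) {x : Euc m} (hx : x ∈ U) : IsHomogDegOne (f x) :=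
  ⟨fun j => (F j).1 x, fun u => (h x hx u).trans (combine_apply _ _ _)⟩

theorem IsComponents.contDiffOn {F : Fin m → SmoothSpace U V} {f : Euc m → Euc m → V}
    (h : IsComponents F f) (u : Euc m) : ContDiffOn ℝ ∞ (fun x => f x u) U :=
  (SmoothSpace.contDiffOn (combine F u)).congr fun x hx => h x hx u

/-- In degree one harmonicity is automatic, so membership in `harmonicOne` reduces to
`IsHomogDegOne`. -/
theorem laplacian_eq_zero_of_isHomogDegOne {p : Euc m → V} (hp : IsHomogDegOne p) (u : Euc m) :
    Laplacian.laplacian p u = 0 := by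
  obtain ⟨c, hc⟩ := hp
  have h : fderiv ℝ p = fun _ => ∑ j, (innerSL ℝ (stdVec j)).smulRight (c j) := by
    funext u
    ext w
    rw [show p = _ from funext hc, fderiv_combination]
    simp [inner_stdVec]
  rw [laplacian_eq_sum, h]
  simp

end SmoothSpace

/-! ### Clifford multiplication on components. -/

namespace SmoothSpace

variable {m : ℕ} {U Ω : Opens (Euc m)}

/-- Left multiplication by an element of `Cl_m(ℂ)`. -/
noncomputable def leftMul (a : ClC m) : ClC m →L[ℝ] ClC m :=
  LinearMap.toContinuousLinearMap (LinearMap.mulLeft ℝ a)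

theorem leftMul_apply (a b : ClC m) : leftMul a b = a * b := rfl

theorem vec_mul_vec_add (x y : Euc m) :
    vec x * vec y + vec y * vec x = algebraMap ℝ (Cl m) (-2 * inner ℝ x y) := by
  rw [vec, vec, CliffordAlgebra.ι_mul_ι_add_swap]
  congr 1
  rw [QuadraticMap.polar, negSq_apply, negSq_apply, negSq_apply, norm_add_sq_real]
  ring

theorem algebraMap_mul_eq_smul (r : ℝ) (b : ClC m) : algebraMap ℝ (ClC m) r * b = r • b :=
  (Algebra.smul_def r b).symm

/-- Left multiplications by the standard basis vectors. -/
noncomputable def clifford (U : Opens (Euc m)) (v : Euc m) :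
    CliffordAction (weyl U (ClC m) v) where
  e i := map (leftMul (toClC (vec (stdVec i))))
  e_e i j f := ext_on fun x hx => by
    have h : toClC (vec (stdVec i)) * (toClC (vec (stdVec j)) * f.1 x) +
        toClC (vec (stdVec j)) * (toClC (vec (stdVec i)) * f.1 x) =
          (-2 * if j = i then 1 else 0 : ℝ) • f.1 x := by
      rw [← mul_assoc, ← mul_assoc, ← add_mul, ← map_mul, ← map_mul, ← map_add,
        vec_mul_vec_add, inner_stdVec, stdVec_apply, AlgHom.commutes,
        algebraMap_mul_eq_smul]
      simp only [eq_comm]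
    rw [map_apply _ _ hx, map_apply _ _ hx, Submodule.coe_sub, Pi.sub_apply, Submodule.coe_neg,
      Pi.neg_apply, map_apply _ _ hx, map_apply _ _ hx]
    simp only [leftMul_apply]
    rw [eq_sub_of_add_eq h]
    by_cases hij : i = j
    · simp only [hij, if_true, Submodule.coe_smul, Pi.smul_apply]
      module
    · simp [hij, Ne.symm hij]
  d_e i _ f := pd_map _ i f
  x_e i _ f := mulReal_map (contDiff_coord v i).contDiffOn _ f

theorem clifford_e_apply (v : Euc m) (i : Fin m) (f : SmoothSpace U (ClC m)) {x : Euc m}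
    (hx : x ∈ U) : ((clifford U v).e i f).1 x = toClC (vec (stdVec i)) * f.1 x :=
  map_apply (leftMul (toClC (vec (stdVec i)))) f hx

theorem IsComponents.diracX {F : Fin m → SmoothSpace U (ClC m)} {f : Euc m → Euc m → ClC m}
    (h : IsComponents F f) (v : Euc m) :
    IsComponents (fun j => (clifford U v).dir (F j)) (diracX f) := fun x hx u => by
  rw [← map_combine, CliffordAction.dir_apply, sum_apply, _root_.diracX, dirac]
  refine Finset.sum_congr rfl fun i _ => ?_
  rw [clifford_e_apply _ _ _ hx, (h.eventuallyEq hx u).fderiv_eq]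
  congr 1
  exact (pd_apply i _ hx).symm

theorem toClC_vec_eq_sum (u : Euc m) :
    toClC (vec u) = ∑ j, u j • toClC (vec (stdVec j)) := by
  conv_lhs => rw [← sum_smul_stdVec u]
  simp [vec]

theorem IsComponents.fermionicOp {F : Fin m → SmoothSpace U (ClC m)}
    {f : Euc m → Euc m → ClC m} (h : IsComponents F f) (v : Euc m) (n : ℕ) :
    IsComponents ((clifford U v).ferm n F) (fermionicOp n f) := fun x hx u => by
  have h1 := ((h.laplaceX_iterate v n).diracX v) x hx u
  have h2 := (h.laplaceX_iterate v n).innerDuDx v hx u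
  have h3 := innerUDx_apply
    (fun x hx u => ((h.diracX v).laplaceX_iterate v (n - 1)).innerDuDx v hx u) v x hx u
  rw [_root_.fermionicOp, h1, h2, h3, toClC_vec_eq_sum, Finset.sum_mul]
  simp only [combine_apply, CliffordAction.ferm, Submodule.coe_sub, Pi.sub_apply,
    Submodule.coe_smul, Pi.smul_apply, smul_sub, Finset.sum_sub_distrib, Finset.smul_sum,
    smul_comm (_ / _ : ℝ), clifford_e_apply _ _ _ hx, smul_mul_assoc]

/-- This turns the differential condition in `u` defining `monogenicOne` into the algebraic
hypothesis `∑ e_i F_i = 0` of the abstract covariance results. -/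
theorem dirac_eq_sum_of_isComponents {F : Fin m → SmoothSpace U (ClC m)}
    {f : Euc m → Euc m → ClC m} (h : IsComponents F f) (v : Euc m) {x : Euc m} (hx : x ∈ U)
    (u : Euc m) : dirac (f x) u = (∑ i, (clifford U v).e i (F i)).1 x := by
  have h1 : f x = fun u => ∑ j, u j • (F j).1 x :=
    funext fun u => (h x hx u).trans (combine_apply _ _ _)
  rw [dirac, sum_apply, h1]
  refine Finset.sum_congr rfl fun i _ => ?_
  rw [clifford_e_apply _ _ _ hx, fderiv_combination]
  simp [stdVec_apply]

end SmoothSpace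

/-! ### Products of vectors and the isometries they induce. -/

open SmoothSpace (vec_mul_vec_add)

section Versor

variable {m : ℕ}

theorem vec_add (x y : Euc m) : vec (x + y) = vec x + vec y := map_add _ _ _

theorem vec_smul (r : ℝ) (x : Euc m) : vec (r • x) = r • vec x := map_smul _ _ _

theorem tilde_mul (a b : Cl m) : tilde (a * b) = tilde b * tilde a :=
  CliffordAlgebra.reverse.map_mul a b

theorem tilde_vec (x : Euc m) : tilde (vec x) = vec x := CliffordAlgebra.reverse_ι x

theorem tilde_tilde (a : Cl m) : tilde (tilde a) = a := CliffordAlgebra.reverse_reverse a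

theorem tilde_zero : tilde (0 : Cl m) = 0 := map_zero _

theorem vec_sq (x : Euc m) : vec x * vec x = (-‖x‖ ^ 2) • (1 : Cl m) := by
  rw [vec_mul_self, Algebra.algebraMap_eq_smul_one]

theorem vectorPart_vec (x : Euc m) : vectorPart (vec x) = x := by
  have h : CliffordAlgebra.equivExterior (negSq m) (vec x) = ExteriorAlgebra.ι ℝ x :=
    CliffordAlgebra.changeForm_ι
      CliffordAlgebra.changeForm.associated_neg_proof x
  rw [vectorPart, h]
  exact ExteriorAlgebra.ι_leftInverse x

theorem scalarPart_smul_one (r : ℝ) : scalarPart (r • (1 : Cl m)) = r := by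
  have h : CliffordAlgebra.equivExterior (negSq m) (algebraMap ℝ _ r) =
      algebraMap ℝ (ExteriorAlgebra ℝ (Euc m)) r :=
    CliffordAlgebra.changeForm_algebraMap
      CliffordAlgebra.changeForm.associated_neg_proof r
  rw [← Algebra.algebraMap_eq_smul_one, scalarPart, h]
  exact ExteriorAlgebra.algebraMap_leftInverse (Euc m) r

/-- The orthogonal reflection in the hyperplane orthogonal to `z`. -/
noncomputable def reflectIso (z : Euc m) : Euc m ≃ₗᵢ[ℝ] Euc m := (ℝ ∙ z)ᗮ.reflection

theorem reflectIso_apply (z u : Euc m) : reflectIso z u = reflectAt z u := by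
  rw [reflectIso, Submodule.reflection_orthogonal_apply, Submodule.reflection_singleton_apply,
    reflectAt, zpow_neg, zpow_ofNat]
  simp only [RCLike.ofReal_real_eq_id, id, div_eq_mul_inv]
  module

theorem vec_mul_vec_mul_vec {z : Euc m} (hz : z ≠ 0) (u : Euc m) :
    vec z * vec u * vec z = ‖z‖ ^ 2 • vec (reflectIso z u) := by
  have h0 : ‖z‖ ≠ 0 := norm_ne_zero_iff.2 hz
  have h := vec_mul_vec_add z u
  rw [reflectIso_apply, reflectAt, sub_eq_add_neg, ← neg_smul, vec_add, vec_smul, mul_assoc,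
    eq_sub_of_add_eq' h, mul_sub, ← mul_assoc, vec_sq, Algebra.algebraMap_eq_smul_one,
    mul_smul_comm, mul_one, smul_mul_assoc, one_mul, zpow_neg, zpow_ofNat]
  match_scalars <;> field_simp

/-- `g` is invertible, with norm `ν`, sign `s`, and acts on vectors through the isometry `R`. -/
structure IsVersor (g : Cl m) (ν s : ℝ) (R : Euc m ≃ₗᵢ[ℝ] Euc m) : Prop where
  pos : 0 < ν
  sign : s = 1 ∨ s = -1
  mul_tilde : g * tilde g = (s * ν ^ 2) • 1
  tilde_mul : tilde g * g = (s * ν ^ 2) • 1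
  mul_star : g * star g = ν ^ 2 • 1
  conj : ∀ u, g * vec u * tilde g = ν ^ 2 • vec (R u)

namespace IsVersor

theorem one : IsVersor (1 : Cl m) 1 1 (LinearIsometryEquiv.refl ℝ (Euc m)) where
  pos := one_pos
  sign := Or.inl rfl
  mul_tilde := by simp [tilde]
  tilde_mul := by simp [tilde]
  mul_star := by simp
  conj u := by simp [tilde]

theorem of_vec {z : Euc m} (hz : z ≠ 0) : IsVersor (vec z) ‖z‖ (-1) (reflectIso z) where
  pos := norm_pos_iff.2 hz
  sign := Or.inr rfl
  mul_tilde := by rw [tilde_vec, vec_sq, neg_one_mul]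
  tilde_mul := by rw [tilde_vec, vec_sq, neg_one_mul]
  mul_star := by
    rw [vec, CliffordAlgebra.star_ι, mul_neg]
    exact (congrArg Neg.neg (vec_sq z)).trans (by simp)
  conj u := by rw [tilde_vec, vec_mul_vec_mul_vec hz]

theorem mul {g h : Cl m} {ν μ s t : ℝ} {R S : Euc m ≃ₗᵢ[ℝ] Euc m} (hg : IsVersor g ν s R)
    (hh : IsVersor h μ t S) : IsVersor (g * h) (ν * μ) (s * t) (S.trans R) where
  pos := mul_pos hg.pos hh.pos
  sign := by rcases hg.sign with rfl | rfl <;> rcases hh.sign with rfl | rfl <;> simp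
  mul_tilde := by
    rw [_root_.tilde_mul, mul_assoc, ← mul_assoc h, hh.mul_tilde, smul_mul_assoc, one_mul,
      mul_smul_comm, hg.mul_tilde, smul_smul]
    ring_nf
  tilde_mul := by
    rw [_root_.tilde_mul, mul_assoc, ← mul_assoc _ g, hg.tilde_mul, smul_mul_assoc, one_mul,
      mul_smul_comm, hh.tilde_mul, smul_smul]
    ring_nf
  mul_star := by
    rw [star_mul, mul_assoc, ← mul_assoc h, hh.mul_star, smul_mul_assoc, one_mul,
      mul_smul_comm, hg.mul_star, smul_smul]
    ring_nf
  conj u := by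
    have : g * h * vec u * tilde (g * h) = g * (h * vec u * tilde h) * tilde g := by
      rw [_root_.tilde_mul]; noncomm_ring
    rw [this, hh.conj, mul_smul_comm, smul_mul_assoc, hg.conj, smul_smul]
    simp [mul_pow, mul_comm]

variable {g : Cl m} {ν s : ℝ} {R : Euc m ≃ₗᵢ[ℝ] Euc m}

theorem clNorm_eq (h : IsVersor g ν s R) : clNorm g = ν := by
  rw [clNorm, h.mul_star, scalarPart_smul_one, Real.sqrt_sq h.pos.le]

theorem sign_mul_self (h : IsVersor g ν s R) : s * s = 1 := by
  rcases h.sign with rfl | rfl <;> norm_num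

theorem mul_inverse_smul (h : IsVersor g ν s R) : g * ((s * (ν ^ 2)⁻¹) • tilde g) = 1 := by
  have := h.pos.ne'
  rw [mul_smul_comm, h.mul_tilde, smul_smul]
  convert one_smul ℝ _
  field_simp
  linear_combination h.sign_mul_self

theorem inverse_smul_mul (h : IsVersor g ν s R) : ((s * (ν ^ 2)⁻¹) • tilde g) * g = 1 := by
  have := h.pos.ne'
  rw [smul_mul_assoc, h.tilde_mul, smul_smul]
  convert one_smul ℝ _
  field_simp
  linear_combination h.sign_mul_self

theorem isUnit (h : IsVersor g ν s R) : IsUnit g :=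
  ⟨⟨g, _, h.mul_inverse_smul, h.inverse_smul_mul⟩, rfl⟩

theorem inverse_eq (h : IsVersor g ν s R) :
    Ring.inverse g = (s * (ν ^ 2)⁻¹) • tilde g :=
  Ring.inverse_unit ⟨g, _, h.mul_inverse_smul, h.inverse_smul_mul⟩

theorem ne_zero (h : IsVersor g ν s R) : g ≠ 0 := h.isUnit.ne_zero

/-- Multiply `g u g̃ = ν² R(u)` on the left by `g⁻¹ = sν⁻² g̃`. This is where `s` enters the
fermionic sign. -/
theorem vec_mul_tilde (h : IsVersor g ν s R) (u : Euc m) :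
    vec u * tilde g = s • (tilde g * vec (R u)) := by
  have h1 := congrArg (fun a => (s * (ν ^ 2)⁻¹) • (tilde g * a)) (h.conj u)
  have h2 := h.inverse_smul_mul
  simp only [← mul_assoc, ← smul_mul_assoc] at h1
  rw [h2, one_mul, mul_smul_comm, smul_mul_assoc, smul_smul] at h1
  rw [h1]
  have := h.pos.ne'
  congr 1
  field_simp

theorem tilde_left_cancel (h : IsVersor g ν s R) {a p : Cl m} (ha : tilde g * a = p) :
    a = (s * (ν ^ 2)⁻¹) • (g * p) := by
  rw [← ha, ← mul_assoc, ← smul_mul_assoc, ← mul_smul_comm, h.mul_inverse_smul, one_mul]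

end IsVersor

/-- A nonzero product has only nonzero factors, each of which acts by a reflection; norms, signs and
isometries then multiply along the list. -/
theorem isVersor_of_isVectorProduct {g : Cl m} (hg : IsVectorProduct g) (h0 : g ≠ 0) :
    ∃ ν s R, IsVersor g ν s R := by
  obtain ⟨l, rfl⟩ := hg
  induction l with
  | nil => exact ⟨_, _, _, IsVersor.one⟩
  | cons y l ih =>
    rw [List.map_cons, List.prod_cons] at h0 ⊢
    have hy : y ≠ 0 := by
      rintro rfl
      exact h0 (by simp [vec])
    obtain ⟨ν, s, R, h⟩ := ih (right_ne_zero_of_mul h0)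
    exact ⟨_, _, _, (IsVersor.of_vec hy).mul h⟩

end Versor

/-! ### Decomposition of Möbius maps into inversions and similarities. -/

section NormalForm

variable {m : ℕ} {a b c d : Cl m}

theorem IsAhlforsVahlen.exists_pseudoDet (h : IsAhlforsVahlen a b c d) :
    ∃ l : ℝ, (l = 1 ∨ l = -1) ∧ a * tilde d - b * tilde c = l • (1 : Cl m) := by
  rcases h.pseudoDet with h | h
  · exact ⟨1, Or.inl rfl, by rw [h, one_smul]⟩
  · exact ⟨-1, Or.inr rfl, by rw [h, neg_smul, one_smul]⟩

/-- The transformation is a similarity when `c = 0`. -/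
theorem IsAhlforsVahlen.similarity_form (h : IsAhlforsVahlen a b c d) (hc : c = 0) :
    ∃ ν s R l e, IsVersor d ν s R ∧ (l = 1 ∨ l = -1) ∧
      a * tilde d - b * tilde c = l • (1 : Cl m) ∧
      ∀ x, (a * vec x + b) * Ring.inverse d = vec (e + (l * (ν ^ 2)⁻¹) • R x) := by
  obtain ⟨l, hl, hdet⟩ := h.exists_pseudoDet
  subst hc
  have had : a * tilde d = l • (1 : Cl m) := by rw [← hdet, tilde_zero, mul_zero, sub_zero]
  have hd : d ≠ 0 := by
    rintro rfl
    rw [tilde_zero, mul_zero] at had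
    have : l ≠ 0 := by rcases hl with rfl | rfl <;> norm_num
    exact smul_ne_zero this one_ne_zero had.symm
  obtain ⟨ν, s, R, hv⟩ := isVersor_of_isVectorProduct h.prod_d hd
  obtain ⟨p, hp⟩ := h.vec_db
  refine ⟨ν, s, R, l, (ν ^ 2)⁻¹ • R p, hv, hl, hdet, fun x => ?_⟩
  have hb := hv.tilde_left_cancel hp.symm
  -- From `a d̃ = l` with `d̃` invertible. Thus `a` and `b` are both left multiples of `d`, and the
  -- quotient becomes a conjugation by `d`.
  have ha : a = (l * (s * (ν ^ 2)⁻¹)) • d := by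
    have := congrArg (fun y => (s * (ν ^ 2)⁻¹) • (y * d)) had
    simp only [mul_assoc, ← mul_smul_comm] at this
    rw [mul_smul_comm, ← smul_mul_assoc, hv.inverse_smul_mul, mul_one] at this
    rw [this, smul_mul_assoc, one_mul, smul_smul]
  have hsum : a * vec x + b = (s * (ν ^ 2)⁻¹) • (d * vec (l • x + p)) := by
    rw [ha, hb, vec_add, vec_smul, mul_add, mul_smul_comm, smul_mul_assoc]
    module
  rw [hsum, hv.inverse_eq, smul_mul_assoc, mul_smul_comm, hv.conj, smul_smul, smul_smul]
  simp only [map_add, map_smul, vec_add, vec_smul, smul_add, smul_smul]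
  have h0 := hv.pos.ne'
  have hs : s ^ 2 = 1 := by rw [sq, hv.sign_mul_self]
  rw [add_comm]
  congr 2
  · field_simp; rw [hs]
  · field_simp; rw [hs]; ring

/-- The transformation is an inversion followed by a similarity when `c ≠ 0`. -/
theorem IsAhlforsVahlen.inversion_form (h : IsAhlforsVahlen a b c d) (hc : c ≠ 0) :
    ∃ ν s R l e v, IsVersor c ν s R ∧ (l = 1 ∨ l = -1) ∧
      a * tilde d - b * tilde c = l • (1 : Cl m) ∧ (∀ x, denom c d x = c * vec (x + v)) ∧
      ∀ x, x + v ≠ 0 → (a * vec x + b) * Ring.inverse (denom c d x) =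
        vec (e + (l * (ν ^ 2)⁻¹) • R (inversionAt v x)) := by
  obtain ⟨l, hl, hdet⟩ := h.exists_pseudoDet
  obtain ⟨ν, s, R, hv⟩ := isVersor_of_isVectorProduct h.prod_c hc
  obtain ⟨p, hp⟩ := h.vec_cd
  obtain ⟨q, hq⟩ := h.vec_ca
  have h0 := hv.pos.ne'
  have hs : s ^ 2 = 1 := by rw [sq, hv.sign_mul_self]
  set v := (ν ^ 2)⁻¹ • R.symm p with hvdef
  -- Solving `c d̃ = p` gives `d̃` as `c̃` times a vector. Moving this vector to the left with
  -- `vec_mul_tilde` rotates it by `R⁻¹`, whence the choice of `v`.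
  have htd : tilde d = vec v * tilde c := by
    have h1 : tilde d = (s * (ν ^ 2)⁻¹) • (tilde c * vec p) := by
      rw [hp, ← mul_assoc, ← smul_mul_assoc, ← smul_mul_assoc, hv.inverse_smul_mul, one_mul]
    rw [h1, hvdef, vec_smul, smul_mul_assoc, hv.vec_mul_tilde, R.apply_symm_apply, smul_smul,
      mul_comm s]
  have hd : d = c * vec v := by
    rw [← tilde_tilde d, htd, tilde_mul, tilde_tilde, tilde_vec]
  have hden : ∀ x, denom c d x = c * vec (x + v) := fun x => by
    rw [denom, vec_add, mul_add, ← hd]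
  refine ⟨ν, s, R, l, (ν ^ 2)⁻¹ • R q, v, hv, hl, hdet, hden, fun x hx => ?_⟩
  have hz : ‖x + v‖ ≠ 0 := norm_ne_zero_iff.2 hx
  have ha := hv.tilde_left_cancel hq.symm
  -- With `d̃ = v c̃` the pseudo-determinant reads `(av - b) c̃ = l`, and `c̃` is cancelled.
  have hb : b = a * vec v - (l * (s * (ν ^ 2)⁻¹)) • c := by
    have := congrArg (fun y => (s * (ν ^ 2)⁻¹) • (y * c)) hdet
    simp only [htd, ← mul_assoc, ← sub_mul] at this
    rw [mul_assoc, ← mul_smul_comm, ← smul_mul_assoc, hv.inverse_smul_mul, mul_one,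
      smul_mul_assoc, one_mul, smul_smul, mul_comm _ l] at this
    rw [← this]; abel
  have hsum : a * vec x + b = (s * (ν ^ 2)⁻¹) • (c * (vec q * vec (x + v) - l • 1)) := by
    rw [hb, ha, vec_add, mul_sub, mul_add, mul_smul_comm, mul_one]
    simp only [smul_mul_assoc, mul_add, mul_assoc]
    module
  -- The inverse of `x + v` is `-(x + v)/|x + v|²`, so multiplying by `x + v` on the right exposes
  -- the inversion as a vector between `c` and `c̃`.
  have hprod : (vec q * vec (x + v) - l • 1) * vec (x + v) =
      (-‖x + v‖ ^ 2) • vec (q + (l * (‖x + v‖ ^ 2)⁻¹) • (x + v)) := by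
    rw [sub_mul, mul_assoc, vec_sq, mul_smul_comm, mul_one, smul_mul_assoc, one_mul,
      vec_add q, vec_smul _ (x + v)]
    match_scalars <;> field_simp
  rw [hden, hsum, (hv.mul (IsVersor.of_vec hx)).inverse_eq, tilde_mul, tilde_vec, smul_mul_assoc,
    mul_smul_comm, ← mul_assoc, mul_assoc c, hprod, mul_smul_comm, smul_mul_assoc,
    hv.conj]
  simp only [map_add, map_smul, vec_add, vec_smul, smul_add, smul_smul, inversionAt]
  have e2 : ‖x + v‖ ^ (-2 : ℤ) = (‖x + v‖ ^ 2)⁻¹ := by rw [zpow_neg, zpow_ofNat]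
  simp only [e2]
  match_scalars <;> field_simp <;> linear_combination (norm := skip) hs
  all_goals ring_nf
  all_goals simp [hs]

end NormalForm

/-! ### Pullbacks of functions of `(x, u)` on components. -/

namespace SmoothSpace

variable {m : ℕ} {U Ω : Opens (Euc m)}

section Rules

variable {V : Type} [NormedAddCommGroup V] [NormedSpace ℝ V] {F : Fin m → SmoothSpace U V}
  {f g : Euc m → Euc m → V}

theorem IsComponents.congr (h : IsComponents F f) (hfg : ∀ x ∈ U, ∀ u, g x u = f x u) :
    IsComponents F g := fun x hx u => (hfg x hx u).trans (h x hx u)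

theorem IsComponents.smul (h : IsComponents F f) (r : ℝ) :
    IsComponents (fun j => r • F j) (fun x u => r • f x u) := fun x hx u => by
  simp only [h x hx, combine_apply, Submodule.coe_smul, Pi.smul_apply, Finset.smul_sum,
    smul_comm r]

theorem IsComponents.map (h : IsComponents F f) (L : V →L[ℝ] V) :
    IsComponents (fun j => SmoothSpace.map L (F j)) (fun x u => L (f x u)) := fun x hx u => by
  simp only [h x hx, combine_apply, map_apply _ _ hx, map_sum, map_smul]

theorem IsComponents.mulNorm {v : Euc m} (h0 : ∀ x ∈ U, x + v ≠ 0)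
    (hU : ∀ x ∈ U, inversionAt v x ∈ Ω) (h : IsComponents F f) (k : ℤ) :
    IsComponents (fun j => (inversion V v h0 hU).ρ k (F j))
      (fun x u => ‖x + v‖ ^ k • f x u) := fun x hx u => by
  simp only [h x hx, combine_apply, inversion_ρ_apply _ _ _ _ _ hx, Finset.smul_sum,
    smul_comm (‖x + v‖ ^ k)]

theorem IsComponents.inversion {F : Fin m → SmoothSpace Ω V} (h : IsComponents F f) {v : Euc m}
    (h0 : ∀ x ∈ U, x + v ≠ 0) (hU : ∀ x ∈ U, inversionAt v x ∈ Ω) :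
    IsComponents (fun j => (inversion V v h0 hU).pull F j)
      (fun x u => f (inversionAt v x) (reflectAt (x + v) u)) := fun x hx u => by
  refine (h _ (hU x hx) _).trans ?_
  rw [combine_apply, combine_apply]
  exact (inversion_pull_apply v h0 hU F hx u).symm

theorem IsComponents.similarity {F : Fin m → SmoothSpace Ω V} (h : IsComponents F f)
    {R : Euc m ≃ₗᵢ[ℝ] Euc m} {t : ℝ} {e : Euc m} (hU : ∀ x ∈ U, e + t • R x ∈ Ω) :
    IsComponents (fun j => (similarity V R t e hU 0).pull F j)
      (fun x u => f (e + t • R x) (R u)) := fun x hx u => by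
  refine (h _ (hU x hx) _).trans ?_
  rw [combine_apply, combine_apply]
  exact (similarity_pull_apply R t e hU 0 F hx u).symm

end Rules

theorem IsComponents.vecX {F : Fin m → SmoothSpace U (ClC m)} {f : Euc m → Euc m → ClC m}
    (h : IsComponents F f) (v : Euc m) : IsComponents (fun j => (clifford U v).vecX (F j))
      (fun x u => toClC (vec (x + v)) * f x u) := fun x hx u => by
  refine (congrArg _ (h x hx u)).trans ?_
  rw [← map_combine, CliffordAction.vecX_apply, sum_apply, toClC_vec_eq_sum,
    Finset.sum_mul]
  refine Finset.sum_congr rfl fun i _ => ?_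
  rw [clifford_e_apply _ _ _ hx, weyl_x_apply _ _ _ hx, smul_mul_assoc, mul_smul_comm]

theorem cliffordInversion {v : Euc m} (h0 : ∀ x ∈ U, x + v ≠ 0)
    (hU : ∀ x ∈ U, inversionAt v x ∈ Ω) :
    CliffordInversion (inversion (ClC m) v h0 hU) (clifford Ω 0) (clifford U v) where
  C_e _ f := comp_map (contDiffOn_inversionAt h0) hU _ f
  ρ_e k _ f := mulReal_map (contDiffOn_norm_add_zpow h0 k) _ f

section Similarity

variable {g : Cl m} {ν s : ℝ} {R : Euc m ≃ₗᵢ[ℝ] Euc m}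

theorem similarity_C_e {t : ℝ} {e : Euc m} (hU : ∀ x ∈ U, e + t • R x ∈ Ω) (i : Fin m)
    (f : SmoothSpace Ω (ClC m)) : (similarity (ClC m) R t e hU 0).C ((clifford Ω 0).e i f) =
      (clifford U 0).e i ((similarity (ClC m) R t e hU 0).C f) :=
  comp_map (contDiff_similarity R t e).contDiffOn hU _ f

theorem e_map_tilde (hv : IsVersor g ν s R) {t : ℝ} {e : Euc m}
    (hU : ∀ x ∈ U, e + t • R x ∈ Ω) (j : Fin m) (f : SmoothSpace U (ClC m)) :
    (clifford U 0).e j (map (leftMul (toClC (tilde g))) f) =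
      s • ∑ i, (similarity (ClC m) R t e hU 0).R i j •
        map (leftMul (toClC (tilde g))) ((clifford U 0).e i f) := ext_on fun x hx => by
  have h : toClC (vec (stdVec j)) * toClC (tilde g) =
      s • ∑ i, R (stdVec j) i • (toClC (tilde g) * toClC (vec (stdVec i))) := by
    rw [← map_mul, hv.vec_mul_tilde, map_smul, map_mul, toClC_vec_eq_sum, Finset.mul_sum]
    simp only [mul_smul_comm]
  rw [clifford_e_apply _ _ _ hx, map_apply _ _ hx, leftMul_apply, ← mul_assoc, h,
    Submodule.coe_smul, Pi.smul_apply, sum_apply, smul_mul_assoc, Finset.sum_mul]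
  congr 1
  refine Finset.sum_congr rfl fun i _ => ?_
  rw [Submodule.coe_smul, Pi.smul_apply, map_apply _ _ hx, clifford_e_apply _ _ _ hx,
    leftMul_apply, ← mul_assoc, smul_mul_assoc]
  rfl

/-- Covariance of the fermionic operators under similarities of smooth functions. -/
theorem ferm_similarity (hv : IsVersor g ν s R) {t : ℝ} {e : Euc m}
    (hU : ∀ x ∈ U, e + t • R x ∈ Ω) (n : ℕ) (F : Fin m → SmoothSpace Ω (ClC m)) (j : Fin m) :
    (clifford U 0).ferm n (fun i => map (leftMul (toClC (tilde g)))
      ((similarity (ClC m) R t e hU 0).pull F i)) j =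
    (s * t ^ (2 * n + 1)) • map (leftMul (toClC (tilde g)))
      ((similarity (ClC m) R t e hU 0).pull ((clifford Ω 0).ferm n F) j) :=
  (similarity (ClC m) R t e hU 0).ferm_pull (similarity_C_e hU) (fun i f => pd_map _ i f)
    (e_map_tilde hv hU) n F j

end Similarity

/-- The preimage of an open set under a similarity. -/
def similarityPreimage (Ω : Opens (Euc m)) (R : Euc m ≃ₗᵢ[ℝ] Euc m) (t : ℝ) (e : Euc m) :
    Opens (Euc m) :=
  ⟨(fun x => e + t • R x) ⁻¹' Ω, Ω.isOpen.preimage (contDiff_similarity R t e).continuous⟩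

/-- The preimage of an open set under the inversion with centre `-v`. -/
def inversionPreimage (Ω : Opens (Euc m)) (v : Euc m) : Opens (Euc m) :=
  ⟨{x | x + v ≠ 0} ∩ inversionAt v ⁻¹' Ω, by
    have h : IsOpen {x : Euc m | x + v ≠ 0} :=
      isOpen_ne_fun (continuous_id.add continuous_const) continuous_const
    exact ContinuousOn.isOpen_inter_preimage
      (fun x hx => (contDiffAt_inversionAt v hx).continuousAt.continuousWithinAt) h Ω.isOpen⟩

end SmoothSpace

/-! ### Weights, and assembly of the covariance results. -/

theorem zpow_weight_even {ν l : ℝ} (hν : 0 < ν) (hl : l = 1 ∨ l = -1) (m n : ℕ) :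
    1 / ν ^ ((m : ℤ) - 2 * n) * (l * (ν ^ 2)⁻¹) ^ (2 * n) = 1 / ν ^ ((m : ℤ) + 2 * n) := by
  have h : l ^ (2 * n) = 1 := by
    rw [pow_mul]; rcases hl with rfl | rfl <;> simp
  rw [mul_pow, h, one_mul, inv_pow, ← pow_mul, one_div, one_div, ← mul_inv, ← zpow_natCast,
    ← zpow_add₀ hν.ne']
  congr 2
  push_cast
  ring

/-- The scaling factor `l/ν²` of the similarity part changes `J_k` into `J_{-k}`; its sign `l`
survives only in odd powers. -/
theorem zpow_weight_odd {ν l : ℝ} (hν : 0 < ν) (hl : l = 1 ∨ l = -1) (m n : ℕ) :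
    1 / ν ^ ((m : ℤ) - 2 * n) * (l * (ν ^ 2)⁻¹) ^ (2 * n + 1) =
      l * (1 / ν ^ ((m : ℤ) + 2 * n + 2)) := by
  rw [pow_succ, ← mul_assoc, zpow_weight_even hν hl, zpow_add₀ hν.ne' _ 2, zpow_ofNat, one_div,
    one_div, mul_inv]
  ring

section Assembly

open SmoothSpace

variable {m : ℕ} {a b c d : Cl m} {ν s l : ℝ} {R : Euc m ≃ₗᵢ[ℝ] Euc m} {e v : Euc m}

theorem IsVersor.mobiusDir_eq {x : Euc m} (h : IsVersor (denom c d x) ν s R) (u : Euc m) :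
    mobiusDir c d x u = R u := by
  rw [mobiusDir, h.conj, h.clNorm_eq, smul_smul, inv_mul_cancel₀ (pow_ne_zero 2 h.pos.ne'),
    one_smul, vectorPart_vec]

theorem IsVersor.vec_mobiusDir {x : Euc m} (h : IsVersor (denom c d x) ν s R) (u : Euc m) :
    vec (mobiusDir c d x u) = (clNorm (denom c d x) ^ 2)⁻¹ •
      (denom c d x * vec u * tilde (denom c d x)) := by
  rw [h.mobiusDir_eq, h.conj, h.clNorm_eq, smul_smul,
    inv_mul_cancel₀ (pow_ne_zero 2 h.pos.ne'), one_smul]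

theorem IsVersor.mul_vec (h : IsVersor c ν s R) {z : Euc m} (hz : z ≠ 0) :
    IsVersor (c * vec z) (ν * ‖z‖) (s * -1) ((reflectIso z).trans R) :=
  h.mul (IsVersor.of_vec hz)

theorem SmoothSpace.IsComponents.smoothOn_harmonicOne {U : TopologicalSpace.Opens (Euc m)}
    {F : Fin m → SmoothSpace U ℂ} {f : Euc m → Euc m → ℂ} (h : IsComponents F f) :
    SmoothOn U (harmonicOne m) f :=
  ⟨fun _ hx => ⟨h.isHomogDegOne hx, laplacian_eq_zero_of_isHomogDegOne (h.isHomogDegOne hx)⟩,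
    h.contDiffOn⟩

theorem bosonic_similarity (hv : IsVersor d ν s R) (hl : l = 1 ∨ l = -1) (hc : c = 0)
    (hφ : ∀ x, (a * vec x + b) * Ring.inverse d = vec (e + (l * (ν ^ 2)⁻¹) • R x))
    {n : ℕ} (hn : 1 ≤ n) {Ω : Set (Euc m)} {f : Euc m → Euc m → ℂ} (hΩ : IsOpen Ω)
    (hf : SmoothOn Ω (harmonicOne m) f) :
    SmoothOn (mobiusPreimage a b c d Ω) (harmonicOne m) (bosonicPullback a b c d n f) ∧
      ∀ x ∈ mobiusPreimage a b c d Ω, ∀ u : Euc m,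
        bosonicWeight c d ((m : ℤ) + 2 * n) x •
            bosonicOp n f (mobius a b c d x) (mobiusDir c d x u) =
          bosonicOp n (bosonicPullback a b c d n f) x u := by
  obtain ⟨hf1, hf2⟩ := hf
  have hden : ∀ x, denom c d x = d := fun x => by rw [denom, hc, zero_mul, zero_add]
  have hmob : ∀ x, mobius a b c d x = e + (l * (ν ^ 2)⁻¹) • R x := fun x => by
    rw [mobius, hden, hφ, vectorPart_vec]
  have hdir : ∀ x u, mobiusDir c d x u = R u := fun x u =>
    IsVersor.mobiusDir_eq (x := x) (by rwa [hden]) u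
  have hw : ∀ k x, bosonicWeight c d k x = 1 / ν ^ k := fun k x => by
    rw [bosonicWeight, hden, hv.clNorm_eq]
  let O : TopologicalSpace.Opens (Euc m) := ⟨Ω, hΩ⟩
  let U := similarityPreimage O R (l * (ν ^ 2)⁻¹) e
  have hset : mobiusPreimage a b c d Ω = U := by
    ext x
    simp only [mobiusPreimage, Set.mem_ofPred_eq, hden, hmob, hv.ne_zero, ne_eq, not_false_eq_true,
      true_and]
    rfl
  have hU : ∀ x ∈ U, e + (l * (ν ^ 2)⁻¹) • R x ∈ O := fun _ hx => hx
  have hF : IsComponents (components (U := O) f hf2) f :=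
    isComponents_components hf2 fun x hx => (hf1 x hx).1
  have hG := ((hF.similarity hU).smul (1 / ν ^ ((m : ℤ) - 2 * n))).congr
    (g := bosonicPullback a b c d n f) fun x _ u => by rw [bosonicPullback, hw, hmob, hdir]
  have hH := ((hF.bosonicOp 0 n).similarity hU).smul (1 / ν ^ ((m : ℤ) + 2 * n))
  rw [hset]
  refine ⟨hG.smoothOn_harmonicOne, fun x hx u => ?_⟩
  rw [hw, hmob, hdir, hG.bosonicOp 0 n x hx]
  refine (hH x hx u).trans ?_
  refine congrArg (fun G => (combine G u).1 x) (funext fun j => ?_)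
  rw [WeylAction.bos_smul]
  refine Eq.trans ?_ (congrArg _ (SimilarityAction.bos_pull _ hn _ j).symm)
  rw [smul_smul]
  exact congrArg (· • _) (zpow_weight_even hv.pos hl m n).symm

theorem bosonic_inversion (hm : 1 ≤ m) (hv : IsVersor c ν s R) (hl : l = 1 ∨ l = -1)
    (hden : ∀ x, denom c d x = c * vec (x + v))
    (hφ : ∀ x, x + v ≠ 0 → (a * vec x + b) * Ring.inverse (denom c d x) =
        vec (e + (l * (ν ^ 2)⁻¹) • R (inversionAt v x)))
    {n : ℕ} (hn : 1 ≤ n) {Ω : Set (Euc m)} {f : Euc m → Euc m → ℂ} (hΩ : IsOpen Ω)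
    (hf : SmoothOn Ω (harmonicOne m) f) :
    SmoothOn (mobiusPreimage a b c d Ω) (harmonicOne m) (bosonicPullback a b c d n f) ∧
      ∀ x ∈ mobiusPreimage a b c d Ω, ∀ u : Euc m,
        bosonicWeight c d ((m : ℤ) + 2 * n) x •
            bosonicOp n f (mobius a b c d x) (mobiusDir c d x u) =
          bosonicOp n (bosonicPullback a b c d n f) x u := by
  obtain ⟨hf1, hf2⟩ := hf
  have hdv : ∀ x, x + v ≠ 0 → IsVersor (denom c d x) _ _ _ := fun x hx => by
    rw [hden]; exact hv.mul_vec hx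
  have hne : ∀ x, denom c d x ≠ 0 ↔ x + v ≠ 0 := fun x =>
    ⟨fun h h' => h (by rw [hden, h', vec, map_zero, mul_zero]), fun h => (hdv x h).ne_zero⟩
  have hmob : ∀ x, x + v ≠ 0 →
      mobius a b c d x = e + (l * (ν ^ 2)⁻¹) • R (inversionAt v x) := fun x hx => by
    rw [mobius, hφ x hx, vectorPart_vec]
  have hdir : ∀ x, x + v ≠ 0 → ∀ u, mobiusDir c d x u = R (reflectAt (x + v) u) := fun x hx u => by
    rw [(hdv x hx).mobiusDir_eq, LinearIsometryEquiv.trans_apply, reflectIso_apply]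
  have hw : ∀ k x, x + v ≠ 0 → bosonicWeight c d k x = 1 / ν ^ k * ‖x + v‖ ^ (-k) :=
    fun k x hx => by
      rw [bosonicWeight, (hdv x hx).clNorm_eq, mul_zpow, zpow_neg, one_div, mul_inv, one_div]
  let O : TopologicalSpace.Opens (Euc m) := ⟨Ω, hΩ⟩
  let O' := similarityPreimage O R (l * (ν ^ 2)⁻¹) e
  let U := inversionPreimage O' v
  have hset : mobiusPreimage a b c d Ω = U := by
    ext x
    simp only [mobiusPreimage, Set.mem_ofPred_eq, hne]
    refine and_congr_right fun hx => ?_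
    rw [hmob x hx]
    rfl
  have hU' : ∀ x ∈ O', e + (l * (ν ^ 2)⁻¹) • R x ∈ O := fun _ hx => hx
  have h0 : ∀ x ∈ U, x + v ≠ 0 := fun _ hx => hx.1
  have hU : ∀ x ∈ U, inversionAt v x ∈ O' := fun _ hx => hx.2
  have hF : IsComponents (components (U := O) f hf2) f :=
    isComponents_components hf2 fun x hx => (hf1 x hx).1
  -- Since `‖cx + d‖ = ν‖x + v‖`, the weight splits into a constant and a power of `‖x + v‖`, and
  -- the pullback is a composite of elementary operations on components.
  have hG := ((((hF.similarity hU').inversion h0 hU).mulNorm h0 hU (2 * n - m)).smul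
    (1 / ν ^ ((m : ℤ) - 2 * n))).congr (g := bosonicPullback a b c d n f) fun x hx u => by
      rw [bosonicPullback, hw _ x (h0 x hx), hmob x (h0 x hx), hdir x (h0 x hx), neg_sub,
        smul_smul]
  have hH := ((((hF.bosonicOp 0 n).similarity hU').inversion h0 hU).mulNorm h0 hU
    (-(2 * n) - m)).smul (1 / ν ^ ((m : ℤ) + 2 * n))
  rw [hset]
  refine ⟨hG.smoothOn_harmonicOne, fun x hx u => ?_⟩
  have hx0 := h0 x hx
  rw [hw _ x hx0, hmob x hx0, hdir x hx0, hG.bosonicOp v n x hx, mul_smul,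
    show -((m : ℤ) + 2 * n) = -(2 * n) - m by ring]
  refine (hH x hx u).trans ?_
  refine congrArg (fun G => (combine G u).1 x) (funext fun j => ?_)
  rw [WeylAction.bos_smul]
  refine Eq.trans ?_ (congrArg _ (InversionAction.bos_pull _ hm hn _ j).symm)
  have hS : (weyl O' ℂ 0).bos n (fun j => (similarity ℂ R (l * (ν ^ 2)⁻¹) e hU' 0).pull
      (components (U := O) f hf2) j) = fun j => (l * (ν ^ 2)⁻¹) ^ (2 * n) •
        (similarity ℂ R (l * (ν ^ 2)⁻¹) e hU' 0).pull
          ((weyl O ℂ 0).bos n (components (U := O) f hf2)) j :=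
    funext fun j => SimilarityAction.bos_pull _ hn _ j
  rw [hS, InversionAction.pull_smul, map_smul, smul_smul, zpow_weight_even hv.pos hl]

theorem toClC_smul (r : ℝ) (g : Cl m) : toClC (r • g) = r • toClC g := map_smul _ _ _

theorem SmoothSpace.sum_e_components {S : Ideal (ClC m)} {U : TopologicalSpace.Opens (Euc m)}
    {F : Fin m → SmoothSpace U (ClC m)} {f : Euc m → Euc m → ClC m} (h : IsComponents F f)
    (hf : ∀ x ∈ U, f x ∈ monogenicOne S) (v : Euc m) : ∑ i, (clifford U v).e i (F i) = 0 :=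
  ext_on fun x hx => by
    rw [← dirac_eq_sum_of_isComponents h v hx 0]
    exact (hf x hx).2.2 0

/-- The weight multiplies from the left, so values stay in the left ideal; monogenicity is the
algebraic hypothesis on the components. -/
theorem smoothOn_fermionicPullback {S : Ideal (ClC m)} {n : ℕ}
    {Ω : Set (Euc m)} {U : TopologicalSpace.Opens (Euc m)} {f : Euc m → Euc m → ClC m}
    {G : Fin m → SmoothSpace U (ClC m)} (hU : mobiusPreimage a b c d Ω = U)
    (hf : ∀ x ∈ Ω, f x ∈ monogenicOne S) (hG : IsComponents G (fermionicPullback a b c d n f))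
    (v : Euc m) (he : ∑ i, (clifford U v).e i (G i) = 0) :
    SmoothOn U (monogenicOne S) (fermionicPullback a b c d n f) := by
  refine ⟨fun x hx => ⟨hG.isHomogDegOne hx, fun u => ?_, fun u => ?_⟩, hG.contDiffOn⟩
  · have hx' : x ∈ mobiusPreimage a b c d Ω := by rwa [hU]
    exact S.mul_mem_left _ ((hf _ hx'.2).2.1 _)
  · rw [dirac_eq_sum_of_isComponents hG v hx u, he]
    rfl

theorem fermionic_similarity (hv : IsVersor d ν s R) (hl : l = 1 ∨ l = -1) (hc : c = 0)
    (hφ : ∀ x, (a * vec x + b) * Ring.inverse d = vec (e + (l * (ν ^ 2)⁻¹) • R x))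
    (n : ℕ) (S : Ideal (ClC m)) {Ω : Set (Euc m)} {f : Euc m → Euc m → ClC m} (hΩ : IsOpen Ω)
    (hf : SmoothOn Ω (monogenicOne S) f) :
    SmoothOn (mobiusPreimage a b c d Ω) (monogenicOne S) (fermionicPullback a b c d n f) ∧
      ∀ x ∈ mobiusPreimage a b c d Ω, ∀ u : Euc m,
        fermionicWeight c d ((m : ℤ) + 2 * n + 2) x *
            fermionicOp n f (mobius a b c d x) (mobiusDir c d x u) =
          (l * s) • fermionicOp n (fermionicPullback a b c d n f) x u := by
  obtain ⟨hf1, hf2⟩ := hf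
  have hden : ∀ x, denom c d x = d := fun x => by rw [denom, hc, zero_mul, zero_add]
  have hmob : ∀ x, mobius a b c d x = e + (l * (ν ^ 2)⁻¹) • R x := fun x => by
    rw [mobius, hden, hφ, vectorPart_vec]
  have hdir : ∀ x u, mobiusDir c d x u = R u := fun x u =>
    IsVersor.mobiusDir_eq (x := x) (by rwa [hden]) u
  have hw : ∀ k x, fermionicWeight c d k x = (1 / ν ^ k) • toClC (tilde d) := fun k x => by
    rw [fermionicWeight, hden, hv.clNorm_eq, toClC_smul]
  let O : TopologicalSpace.Opens (Euc m) := ⟨Ω, hΩ⟩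
  let U := similarityPreimage O R (l * (ν ^ 2)⁻¹) e
  have hset : mobiusPreimage a b c d Ω = U := by
    ext x
    simp only [mobiusPreimage, Set.mem_ofPred_eq, hden, hmob, hv.ne_zero, ne_eq,
      not_false_eq_true, true_and]
    rfl
  have hU : ∀ x ∈ U, e + (l * (ν ^ 2)⁻¹) • R x ∈ O := fun _ hx => hx
  have hF : IsComponents (components (U := O) f hf2) f :=
    isComponents_components hf2 fun x hx => (hf1 x hx).1
  have he := sum_e_components hF hf1 0
  have hG := (((hF.similarity hU).map (leftMul (toClC (tilde d)))).smul
    (1 / ν ^ ((m : ℤ) - 2 * n))).congr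
    (g := fermionicPullback a b c d n f) fun x _ u => by
      rw [fermionicPullback, hw, hmob, hdir, smul_mul_assoc, leftMul_apply]
  have hH := (((hF.fermionicOp 0 n).similarity hU).map (leftMul (toClC (tilde d)))).smul
    (1 / ν ^ ((m : ℤ) + 2 * n + 2))
  have heG := SimilarityAction.sum_e_pull _ (similarity_C_e hU) (e_map_tilde hv hU) _ he
  rw [hset]
  refine ⟨smoothOn_fermionicPullback hset hf1 hG 0 ?_, fun x hx u => ?_⟩
  · simp only [map_smul, ← Finset.smul_sum, heG, smul_zero]
  rw [hw, hmob, hdir, smul_mul_assoc, ← leftMul_apply]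
  refine (hH x hx u).trans (Eq.trans ?_ (((hG.fermionicOp 0 n).smul (l * s)) x hx u).symm)
  refine congrArg (fun G => (combine G u).1 x) (funext fun j => ?_)
  rw [CliffordAction.ferm_smul]
  refine Eq.trans ?_ (congrArg (fun y => _ • _ • y) (ferm_similarity hv hU n _ j).symm)
  rw [smul_smul, smul_smul]
  refine congrArg (· • _) ?_
  have h1 := zpow_weight_odd hv.pos hl m n
  have hl2 : l * l = 1 := by rcases hl with rfl | rfl <;> norm_num
  -- The squares of the signs are inserted to match `l * s` on the right with the factor `s` from
  -- `ferm_similarity` and the odd power of `l`.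
  calc _ = (s * s) * (l * l) * (1 / ν ^ ((m : ℤ) + 2 * n + 2)) := by
        rw [hl2, hv.sign_mul_self]; ring
    _ = (s * s) * l * (l * (1 / ν ^ ((m : ℤ) + 2 * n + 2))) := by ring
    _ = _ := by rw [← h1]; ring

theorem fermionic_inversion (hm : 1 ≤ m) (hv : IsVersor c ν s R) (hl : l = 1 ∨ l = -1)
    (hden : ∀ x, denom c d x = c * vec (x + v))
    (hφ : ∀ x, x + v ≠ 0 → (a * vec x + b) * Ring.inverse (denom c d x) =
        vec (e + (l * (ν ^ 2)⁻¹) • R (inversionAt v x)))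
    (n : ℕ) (S : Ideal (ClC m)) {Ω : Set (Euc m)} {f : Euc m → Euc m → ClC m} (hΩ : IsOpen Ω)
    (hf : SmoothOn Ω (monogenicOne S) f) :
    SmoothOn (mobiusPreimage a b c d Ω) (monogenicOne S) (fermionicPullback a b c d n f) ∧
      ∀ x ∈ mobiusPreimage a b c d Ω, ∀ u : Euc m,
        fermionicWeight c d ((m : ℤ) + 2 * n + 2) x *
            fermionicOp n f (mobius a b c d x) (mobiusDir c d x u) =
          (-(l * s)) • fermionicOp n (fermionicPullback a b c d n f) x u := by
  obtain ⟨hf1, hf2⟩ := hf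
  have hdv : ∀ x, x + v ≠ 0 → IsVersor (denom c d x) _ _ _ := fun x hx => by
    rw [hden]; exact hv.mul_vec hx
  have hne : ∀ x, denom c d x ≠ 0 ↔ x + v ≠ 0 := fun x =>
    ⟨fun h h' => h (by rw [hden, h', vec, map_zero, mul_zero]), fun h => (hdv x h).ne_zero⟩
  have hmob : ∀ x, x + v ≠ 0 →
      mobius a b c d x = e + (l * (ν ^ 2)⁻¹) • R (inversionAt v x) := fun x hx => by
    rw [mobius, hφ x hx, vectorPart_vec]
  have hdir : ∀ x, x + v ≠ 0 → ∀ u, mobiusDir c d x u = R (reflectAt (x + v) u) := fun x hx u => by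
    rw [(hdv x hx).mobiusDir_eq, LinearIsometryEquiv.trans_apply, reflectIso_apply]
  -- Reversion gives `(c(x + v))~ = (x + v) c̃`: the factor `c̃` belongs to the similarity, while `x
  -- + v` is the vector factor that accompanies the inversion.
  have hw : ∀ k x, x + v ≠ 0 → ∀ y, fermionicWeight c d k x * y =
      (1 / ν ^ k) • (toClC (vec (x + v)) * (‖x + v‖ ^ (-k) • (toClC (tilde c) * y))) :=
    fun k x hx y => by
      rw [fermionicWeight, (hdv x hx).clNorm_eq, hden, tilde_mul, tilde_vec, toClC_smul, map_mul,
        mul_zpow, smul_mul_assoc, mul_smul_comm, smul_smul, mul_assoc, zpow_neg, one_div, mul_inv,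
        one_div]
  let O : TopologicalSpace.Opens (Euc m) := ⟨Ω, hΩ⟩
  let O' := similarityPreimage O R (l * (ν ^ 2)⁻¹) e
  let U := inversionPreimage O' v
  have hset : mobiusPreimage a b c d Ω = U := by
    ext x
    simp only [mobiusPreimage, Set.mem_ofPred_eq, hne]
    refine and_congr_right fun hx => ?_
    rw [hmob x hx]
    rfl
  have hU' : ∀ x ∈ O', e + (l * (ν ^ 2)⁻¹) • R x ∈ O := fun _ hx => hx
  have h0 : ∀ x ∈ U, x + v ≠ 0 := fun _ hx => hx.1
  have hU : ∀ x ∈ U, inversionAt v x ∈ O' := fun _ hx => hx.2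
  have hF : IsComponents (components (U := O) f hf2) f :=
    isComponents_components hf2 fun x hx => (hf1 x hx).1
  have he := sum_e_components hF hf1 0
  have hG := ((((((hF.similarity hU').map (leftMul (toClC (tilde c)))).inversion h0 hU).mulNorm
    h0 hU (2 * n - m)).vecX v).smul (1 / ν ^ ((m : ℤ) - 2 * n))).congr
    (g := fermionicPullback a b c d n f) fun x hx u => by
      rw [fermionicPullback, hw _ x (h0 x hx), hmob x (h0 x hx), hdir x (h0 x hx), neg_sub,
        leftMul_apply]
  have hH := ((((((hF.fermionicOp 0 n).similarity hU').map (leftMul (toClC (tilde c)))).inversion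
    h0 hU).mulNorm h0 hU (-(2 * n) - m - 2)).vecX v).smul (1 / ν ^ ((m : ℤ) + 2 * n + 2))
  have heT := SimilarityAction.sum_e_pull _ (similarity_C_e hU') (e_map_tilde hv hU') _ he
  have hI := cliffordInversion h0 hU
  have heG := hI.sum_e_vecX_pull (2 * n - m) _ heT
  rw [hset]
  refine ⟨smoothOn_fermionicPullback hset hf1 hG v ?_, fun x hx u => ?_⟩
  · simp only [map_smul, ← Finset.smul_sum, heG, smul_zero]
  have hx0 := h0 x hx
  rw [hw _ x hx0, hmob x hx0, hdir x hx0, 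
    ← leftMul_apply (toClC (tilde c)),
    show -((m : ℤ) + 2 * n + 2) = -(2 * n) - m - 2 by ring]
  refine (hH x hx u).trans (Eq.trans ?_ (((hG.fermionicOp v n).smul (-(l * s))) x hx u).symm)
  refine congrArg (fun G => (combine G u).1 x) (funext fun j => ?_)
  rw [CliffordAction.ferm_smul]
  refine Eq.trans ?_ (congrArg (fun y => _ • _ • y) (hI.ferm_pull n hm _ heT j).symm)
  have hS : (clifford O' 0).ferm n (fun j => SmoothSpace.map (leftMul (toClC (tilde c)))
      ((similarity (ClC m) R (l * (ν ^ 2)⁻¹) e hU' 0).pull (components (U := O) f hf2) j)) =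
      fun j => (s * (l * (ν ^ 2)⁻¹) ^ (2 * n + 1)) •
        SmoothSpace.map (leftMul (toClC (tilde c)))
          ((similarity (ClC m) R (l * (ν ^ 2)⁻¹) e hU' 0).pull
            ((clifford O 0).ferm n (components (U := O) f hf2)) j) :=
    funext fun j => ferm_similarity hv hU' n _ j
  -- The minus sign of `ferm_pull` cancels the one in `-(l * s)`, leaving the same scalar identity
  -- as for a similarity.
  rw [hS, InversionAction.pull_smul, map_smul, map_smul, smul_neg, smul_neg, neg_smul, neg_neg,
    smul_smul, smul_smul]
  refine congrArg (· • _) ?_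
  have h1 := zpow_weight_odd hv.pos hl m n
  have hl2 : l * l = 1 := by rcases hl with rfl | rfl <;> norm_num
  calc _ = (s * s) * (l * l) * (1 / ν ^ ((m : ℤ) + 2 * n + 2)) := by
        rw [hl2, hv.sign_mul_self]; ring
    _ = (s * s) * l * (l * (1 / ν ^ ((m : ℤ) + 2 * n + 2))) := by ring
    _ = _ := by rw [← h1]; ring

theorem mul_sign_eq {l s : ℝ} (hl : l = 1 ∨ l = -1) (hs : s = 1 ∨ s = -1) :
    l * s = 1 ∨ l * s = -1 := by
  rcases hl with rfl | rfl <;> rcases hs with rfl | rfl <;> norm_num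

end Assembly

/-! ### The main theorem. -/

theorem mainTheorem7 (m : ℕ) (hm : 1 ≤ m) (a b c d : Cl m) (h : IsAhlforsVahlen a b c d) :
    -- the quotient `(ax+b)(cx+d)^{-1}` and the direction `w` are well-defined vectors
    (∀ x : Euc m, denom c d x ≠ 0 →
      IsUnit (denom c d x) ∧
      vec (mobius a b c d x) = (a * vec x + b) * Ring.inverse (denom c d x) ∧
      ∀ u : Euc m, vec (mobiusDir c d x u) =
        (clNorm (denom c d x) ^ 2)⁻¹ • (denom c d x * vec u * tilde (denom c d x))) ∧
    -- bosonic operators, order `2n`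
    (∀ n : ℕ, 1 ≤ n → ∀ (Ω : Set (Euc m)) (f : Euc m → Euc m → ℂ), IsOpen Ω →
      SmoothOn Ω (harmonicOne m) f →
      SmoothOn (mobiusPreimage a b c d Ω) (harmonicOne m) (bosonicPullback a b c d n f) ∧
      ∀ x ∈ mobiusPreimage a b c d Ω, ∀ u : Euc m,
        bosonicWeight c d ((m : ℤ) + 2 * n) x •
            bosonicOp n f (mobius a b c d x) (mobiusDir c d x u) =
          bosonicOp n (bosonicPullback a b c d n f) x u) ∧
    -- fermionic operators, order `2n+1`; the sign `σ` depends on the matrix only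
    (∃ σ : ℝ, (σ = 1 ∨ σ = -1) ∧
      (∀ x : Euc m, denom c d x ≠ 0 →
        (a * tilde d - b * tilde c) * (denom c d x * tilde (denom c d x)) =
          algebraMap ℝ (Cl m) (σ * clNorm (denom c d x) ^ 2)) ∧
      ∀ (n : ℕ) (S : Ideal (ClC m)) (Ω : Set (Euc m)) (f : Euc m → Euc m → ClC m), IsOpen Ω →
        SmoothOn Ω (monogenicOne S) f →
        SmoothOn (mobiusPreimage a b c d Ω) (monogenicOne S) (fermionicPullback a b c d n f) ∧
        ∀ x ∈ mobiusPreimage a b c d Ω, ∀ u : Euc m,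
          fermionicWeight c d ((m : ℤ) + 2 * n + 2) x *
              fermionicOp n f (mobius a b c d x) (mobiusDir c d x u) =
            σ • fermionicOp n (fermionicPullback a b c d n f) x u) := by

  by_cases hc : c = 0
  · obtain ⟨ν, s, R, l, e, hv, hl, hdet, hφ⟩ := h.similarity_form hc
    have hden : ∀ x, denom c d x = d := fun x => by rw [denom, hc, zero_mul, zero_add]
    have hdv : ∀ x, IsVersor (denom c d x) ν s R := fun x => by rwa [hden]
    refine ⟨fun x _ => ⟨(hdv x).isUnit, ?_, fun u => (hdv x).vec_mobiusDir u⟩,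
      fun n hn Ω f hΩ hf => bosonic_similarity hv hl hc hφ hn hΩ hf,
      -- Here `cx + d = d` and `d d̃ = sν²`, so `σ` is the pseudo-determinant times `s`.
      l * s, mul_sign_eq hl hv.sign, fun x _ => ?_,
      fun n S Ω f hΩ hf => fermionic_similarity hv hl hc hφ n S hΩ hf⟩
    · rw [mobius, hden, hφ, vectorPart_vec]
    · rw [hdet, (hdv x).mul_tilde, (hdv x).clNorm_eq, smul_mul_assoc, one_mul, smul_smul,
        Algebra.algebraMap_eq_smul_one, mul_assoc]
  · obtain ⟨ν, s, R, l, e, v, hv, hl, hdet, hden, hφ⟩ := h.inversion_form hc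
    have hne : ∀ x, denom c d x ≠ 0 → x + v ≠ 0 := fun x h h' =>
      h (by rw [hden, h', vec, map_zero, mul_zero])
    have hdv : ∀ x, denom c d x ≠ 0 → IsVersor (denom c d x) _ _ _ := fun x hx => by
      have := hv.mul_vec (hne x hx)
      rwa [← hden] at this
    refine ⟨fun x hx => ⟨(hdv x hx).isUnit, ?_, fun u => (hdv x hx).vec_mobiusDir u⟩,
      fun n hn Ω f hΩ hf => bosonic_inversion hm hv hl hden hφ hn hΩ hf,
      -- Here `cx + d = c(x + v)`, and the extra vector factor, whose square is negative, reverses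
      -- the sign.
      -(l * s), ?_, fun x hx => ?_,
      fun n S Ω f hΩ hf => fermionic_inversion hm hv hl hden hφ n S hΩ hf⟩
    · rw [mobius, hφ x (hne x hx), vectorPart_vec]
    · rcases mul_sign_eq hl hv.sign with h | h <;> simp [h]
    · rw [hdet, (hdv x hx).mul_tilde, (hdv x hx).clNorm_eq, smul_mul_assoc, one_mul, smul_smul,
        Algebra.algebraMap_eq_smul_one]
      ring_nf
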